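/- **Theorem.** The deep inference system $\mathsf{KS}$ polynomially simulates tree-like Resolution over sets: there is a polynomial-time algorithm that transforms every tree-like Resolution refutation of finite sets of literals $\Gamma_1,\dots,\Gamma_s$ into a $\mathsf{KS}$ proof of $\overline{\bigwedge_{r}\bigvee\Gamma_r}=\bigvee_{r}\bigwedge_{a\in\Gamma_r}\bar a$; moreover, the number of atom occurrences of this proof is bounded by a polynomial in the size of the refutation (number of clauses plus number of literal occurrences, initial clauses included). Here formulae are built from literals ("atoms": propositional variables $x$ and their duals $\bar x$), $\top$, $\bot$ by $\wedge$, $\vee$; the empty disjunction is $\bot$ and the empty conjunction is $\top$; $\bar A$ is the De Morgan dual of $A$. *$\mathsf{KS}$* has the rules (premiss $\to$ conclusion, $a$ a literal, $A,B,C,D$ formulae): identity $\top\to a\vee\bar a$; weakening $\bot\to a$; contraction $a\vee a\to a$; switch $A\wedge(B\vee C)\to(A\wedge B)\vee C$; medial $(A\wedge B)\vee(C\wedge D)\to(A\vee C)\wedge(B\vee D)$; and $A\to B$ whenever $A=B$, where $=$ is the least equivalence relation closed under contexts that contains commutativity and associativity of $\wedge,\vee$ and $A\vee\bot=A$, $A\wedge\top=A$,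 $\top\vee\top=\top$, $\bot\wedge\bot=\bot$. Derivations are defined inductively: a formula $A$ is a derivation with premiss and conclusion $A$; if $\Phi,\Psi$ are derivations and $\star\in\{\wedge,\vee\}$, then $\Phi\star\Psi$ is a derivation whose premiss (conclusion) is the $\star$ of the premisses (conclusions); if the conclusion of $\Phi$ and the premiss of $\Psi$ are the premiss and conclusion of an instance of a rule, then $\Phi$ above $\Psi$ is a derivation from the premiss of $\Phi$ to the conclusion of $\Psi$. A *$\mathsf{KS}$ proof* of $B$ is a derivation with premiss $\top$ and conclusion $B$. A *Resolution refutation* of $\Gamma_1,\dots,\Gamma_s$ is a list $(\Delta_1,\dots,\Delta_n)$ of finite sets of literals with $\Delta_n=\emptyset$, in which each line is given with its justification: it is some $\Gamma_j$, or is obtained from one or two earlier lines by weakening (from $\Gamma$ infer $\Gamma\cup\Delta$) or by resolution (from $\Gamma\cup\{a\}$ and $\Delta\cup\{\bar a\}$ infer $\Gamma\cup\Delta$). It is *tree-like* if each line is used at most once as a premiss of an inference step. -/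

import Mathlib

namespace DeepInf

/-! ### Literals and formulae (in negation normal form) -/

/-- A literal ("atom"): a propositional variable, or its dual when `neg = true`. -/
structure Literal where
  var : ℕ
  neg : Bool
  deriving DecidableEq

namespace Literal

def dual (a : Literal) : Literal := ⟨a.var, !a.neg⟩

/-- Literals are ordered lexicographically; the order only fixes in which order the members of a
finite set of literals are written down. -/
instance : LinearOrder Literal :=
  LinearOrder.lift' (fun a : Literal => toLex (a.var, a.neg)) (by
    rintro ⟨v, s⟩ ⟨w, t⟩ h
    have h' : (v, s) = (w, t) := toLex.injective h
    cases h'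
    rfl)

end Literal

/-- Formulae over the basis `⊤, ⊥, ∧, ∨`. -/
inductive Formula where
  | bot : Formula
  | top : Formula
  | lit : Literal → Formula
  | and : Formula → Formula → Formula
  | or : Formula → Formula → Formula

namespace Formula

/-- The De Morgan dual. -/
def dual : Formula → Formula
  | bot => top
  | top => bot
  | lit a => lit a.dual
  | and A B => or A.dual B.dual
  | or A B => and A.dual B.dual

/-- The number of atom occurrences. -/
def size : Formula → ℕ
  | bot => 0
  | top => 0
  | lit _ => 1
  | and A B => A.size + B.size
  | or A B => A.size + B.size

/-- The disjunction of a list of formulae; the empty disjunction is `⊥`. -/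
def bigOr : List Formula → Formula
  | [] => bot
  | [A] => A
  | A :: B :: l => or A (bigOr (B :: l))

/-- The conjunction of a list of formulae; the empty conjunction is `⊤`. -/
def bigAnd : List Formula → Formula
  | [] => top
  | [A] => A
  | A :: B :: l => and A (bigAnd (B :: l))

/-- The least relation containing the commutativity, associativity and unit equations that is
closed under reflexivity, symmetry, transitivity and contexts. -/
inductive Equal : Formula → Formula → Prop
  | orComm (A B : Formula) : Equal (or A B) (or B A)
  | andComm (A B : Formula) : Equal (and A B) (and B A)
  | orAssoc (A B C : Formula) : Equal (or (or A B) C) (or A (or B C))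
  | andAssoc (A B C : Formula) : Equal (and (and A B) C) (and A (and B C))
  | orBot (A : Formula) : Equal (or A bot) A
  | andTop (A : Formula) : Equal (and A top) A
  | topTop : Equal (or top top) top
  | botBot : Equal (and bot bot) bot
  | refl (A : Formula) : Equal A A
  | symm {A B : Formula} : Equal A B → Equal B A
  | trans {A B C : Formula} : Equal A B → Equal B C → Equal A C
  | ctxOr {A B : Formula} (C : Formula) : Equal A B → Equal (or C A) (or C B)
  | ctxAnd {A B : Formula} (C : Formula) : Equal A B → Equal (and C A) (and C B)

end Formula

/-! ### The deep inference system `KS` -/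

/-- The names of the rules of `KS`: atomic identity, atomic weakening, atomic contraction, switch,
medial, and the logical rule `=`, which every system contains. -/
inductive KSRule where
  | aid | awd | acd | switch | medial | eq

open Formula in
/-- `ρ.Instance A B`: the rule `ρ` has an instance with premiss `A` and conclusion `B`. -/
inductive KSRule.Instance : KSRule → Formula → Formula → Prop
  | aid (a : Literal) : Instance .aid top (or (lit a) (lit a.dual))
  | awd (a : Literal) : Instance .awd bot (lit a)
  | acd (a : Literal) : Instance .acd (or (lit a) (lit a)) (lit a)
  | switch (A B C : Formula) : Instance .switch (and A (or B C)) (or (and A B) C)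
  | medial (A B C D : Formula) :
      Instance .medial (or (and A B) (and C D)) (and (or A C) (or B D))
  | eq {A B : Formula} : Formula.Equal A B → Instance .eq A B

/-- Derivations as written objects: formulae, compositions by a connective, and vertical
compositions of an upper derivation and a lower derivation through a rule. That each vertical
composition is indeed an instance of its rule is the predicate `Derivation.Valid`. -/
inductive Derivation where
  | formula : Formula → Derivation
  | and : Derivation → Derivation → Derivation
  | or : Derivation → Derivation → Derivation
  | step : KSRule → Derivation → Derivation → Derivation

namespace Derivation

/-- The premiss. -/
def pr : Derivation → Formula
  | formula A => A
  | and Φ Ψ => Formula.and Φ.pr Ψ.pr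
  | or Φ Ψ => Formula.or Φ.pr Ψ.pr
  | step _ Φ _ => Φ.pr

/-- The conclusion. -/
def cn : Derivation → Formula
  | formula A => A
  | and Φ Ψ => Formula.and Φ.cn Ψ.cn
  | or Φ Ψ => Formula.or Φ.cn Ψ.cn
  | step _ _ Ψ => Ψ.cn

/-- Every vertical composition is an instance of the named rule of `KS`. -/
def Valid : Derivation → Prop
  | formula _ => True
  | and Φ Ψ => Φ.Valid ∧ Ψ.Valid
  | or Φ Ψ => Φ.Valid ∧ Ψ.Valid
  | step ρ Φ Ψ => Φ.Valid ∧ Ψ.Valid ∧ ρ.Instance Φ.cn Ψ.pr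

/-- The number of atom occurrences. -/
def size : Derivation → ℕ
  | formula A => A.size
  | and Φ Ψ => Φ.size + Ψ.size
  | or Φ Ψ => Φ.size + Ψ.size
  | step _ Φ Ψ => Φ.size + Ψ.size

/-- `Φ` is a `KS` proof of `A`: a `KS` derivation with premiss `⊤` and conclusion `A`. -/
def IsKSProofOf (Φ : Derivation) (A : Formula) : Prop :=
  Φ.Valid ∧ Φ.pr = Formula.top ∧ Φ.cn = A

end Derivation

/-! ### Tree-like Resolution over sets -/

/-- A clause is a finite set of literals. -/
abbrev Clause := Finset Literal

/-- The disjunction of the members of a clause. -/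
def Clause.toFormula (Γ : Clause) : Formula :=
  Formula.bigOr ((Γ.sort (· ≤ ·)).map Formula.lit)

/-- The conjunction of a list of clauses. -/
def cnf (Γs : List Clause) : Formula :=
  Formula.bigAnd (Γs.map Clause.toFormula)

/-- How a line of a Resolution derivation was obtained: it is the `j`-th initial clause, or the
conclusion of a weakening step with the `i`-th line as premiss, or the conclusion of a resolution
step on the literal `a` with the `i`-th and the `j`-th line as premisses (counting from `0`). -/
inductive Reason where
  | initial (j : ℕ)
  | wk (i : ℕ)
  | res (i j : ℕ) (a : Literal)

/-- The indices of the premisses. -/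
def Reason.premisses : Reason → List ℕ
  | initial _ => []
  | wk i => [i]
  | res i j _ => [i, j]

structure Line where
  clause : Clause
  reason : Reason

/-- A list of initial clauses together with a list of lines. -/
structure ResDerivation where
  initial : List Clause
  lines : List Line

namespace ResDerivation

/-- `E` follows by the weakening rule from `C`. -/
def WkStep (C E : Clause) : Prop := ∃ Δ : Clause, E = C ∪ Δ

/-- `E` follows by the resolution rule on `a` from `C` and `D`. -/
def ResStep (a : Literal) (C D E : Clause) : Prop :=
  ∃ Γ Δ : Clause, C = Γ ∪ {a} ∧ D = Δ ∪ {a.dual} ∧ E = Γ ∪ Δ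

/-- The reason given for a clause `E` in line `k` is correct. -/
def Justified (π : ResDerivation) (k : ℕ) (E : Clause) : Reason → Prop
  | .initial j => π.initial[j]? = some E
  | .wk i => i < k ∧ ∃ l, π.lines[i]? = some l ∧ WkStep l.clause E
  | .res i j a => i < k ∧ j < k ∧
      ∃ l m, π.lines[i]? = some l ∧ π.lines[j]? = some m ∧ ResStep a l.clause m.clause E

/-- `π` is a Resolution derivation from its initial clauses. -/
def IsDerivation (π : ResDerivation) : Prop :=
  ∀ (k : ℕ) (l : Line), π.lines[k]? = some l → π.Justified k l.clause l.reason

/-- The last line is the empty clause. -/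
def EndsInEmpty (π : ResDerivation) : Prop :=
  ∃ l, π.lines.getLast? = some l ∧ l.clause = ∅

/-- Each line is used at most once as a premiss. -/
def TreeLike (π : ResDerivation) : Prop :=
  (π.lines.flatMap fun l => l.reason.premisses).Nodup

/-- `π` is a tree-like Resolution refutation of its initial clauses. -/
def IsTreeLikeRefutation (π : ResDerivation) : Prop :=
  π.IsDerivation ∧ π.EndsInEmpty ∧ π.TreeLike

/-- The number of clauses plus the number of literal occurrences, initial clauses included. -/
def size (π : ResDerivation) : ℕ :=
  (π.initial.map fun Γ => Γ.card + 1).sum + (π.lines.map fun l => l.clause.card + 1).sum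

end ResDerivation

/-! ### Polynomial time

The machine model is the WHILE language over binary trees. Every operation is charged for the
full size of the data that it reads or writes (there is no sharing of subtrees), so that each
operation can be carried out by a Turing machine in time polynomial in its cost, and conversely. -/

/-- The data of WHILE programs: binary trees. -/
inductive Data where
  | nil : Data
  | cons : Data → Data → Data
  deriving DecidableEq

namespace Data

/-- The number of nodes. -/
def size : Data → ℕ
  | nil => 1
  | cons d e => 1 + d.size + e.size

def hd : Data → Data
  | nil => nil
  | cons d _ => d

def tl : Data → Data
  | nil => nil
  | cons _ e => e

def ofBool : Bool → Data
  | false => nil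
  | true => cons nil nil

def ofList : List Data → Data
  | [] => nil
  | d :: l => cons d (ofList l)

/-- Unary notation, used for tags and for positions in lists. -/
def unary (n : ℕ) : Data := ofList (List.replicate n nil)

/-- Binary notation, used for the names of variables. -/
def binary (n : ℕ) : Data := ofList (n.bits.map ofBool)

end Data

/-- A memory assigns a tree to each variable of the program. -/
abbrev Store := ℕ → Data

inductive Exp where
  | var (x : ℕ)
  | nil
  | cons (e f : Exp)
  | hd (e : Exp)
  | tl (e : Exp)
  | eq (e f : Exp)

namespace Exp

def eval (σ : Store) : Exp → Data
  | var x => σ x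
  | nil => Data.nil
  | cons e f => Data.cons (e.eval σ) (f.eval σ)
  | hd e => (e.eval σ).hd
  | tl e => (e.eval σ).tl
  | eq e f => Data.ofBool (decide (e.eval σ = f.eval σ))

def cost (σ : Store) : Exp → ℕ
  | var x => 1 + (σ x).size
  | nil => 1
  | cons e f => 1 + e.cost σ + f.cost σ
  | hd e => 1 + e.cost σ
  | tl e => 1 + e.cost σ
  | eq e f => 1 + e.cost σ + f.cost σ

end Exp

inductive Cmd where
  | skip
  | assign (x : ℕ) (e : Exp)
  | seq (c d : Cmd)
  | ite (e : Exp) (c d : Cmd)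
  | while (e : Exp) (c : Cmd)

/-- `Run c σ τ t`: started in the memory `σ`, the program `c` halts in the memory `τ` after
time `t`. In tests, `nil` is false and every other tree is true. -/
inductive Run : Cmd → Store → Store → ℕ → Prop
  | skip (σ : Store) : Run .skip σ σ 1
  | assign (x : ℕ) (e : Exp) (σ : Store) :
      Run (.assign x e) σ (Function.update σ x (e.eval σ)) (1 + e.cost σ)
  | seq {c d : Cmd} {σ τ υ : Store} {s t : ℕ} :
      Run c σ τ s → Run d τ υ t → Run (.seq c d) σ υ (1 + s + t)
  | iteTrue {e : Exp} {c d : Cmd} {σ τ : Store} {t : ℕ} :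
      e.eval σ ≠ .nil → Run c σ τ t → Run (.ite e c d) σ τ (1 + e.cost σ + t)
  | iteFalse {e : Exp} {c d : Cmd} {σ τ : Store} {t : ℕ} :
      e.eval σ = .nil → Run d σ τ t → Run (.ite e c d) σ τ (1 + e.cost σ + t)
  | whileFalse {e : Exp} {c : Cmd} {σ : Store} :
      e.eval σ = .nil → Run (.while e c) σ σ (1 + e.cost σ)
  | whileTrue {e : Exp} {c : Cmd} {σ τ υ : Store} {s t : ℕ} :
      e.eval σ ≠ .nil → Run c σ τ s → Run (.while e c) τ υ t →
      Run (.while e c) σ υ (1 + e.cost σ + s + t)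

/-- The initial memory: the input in variable `0`, all other variables `nil`. -/
def Store.init (d : Data) : Store := Function.update (fun _ => Data.nil) 0 d

/-- Some program computes `f` on the inputs in `S` in time polynomial in the size of the encoded
input; the output is left in variable `0`. -/
def PolyTimeOn {α β : Type*} (S : Set α) (encIn : α → Data) (encOut : β → Data) (f : α → β) :
    Prop :=
  ∃ (c : Cmd) (p : Polynomial ℕ), ∀ x ∈ S, ∃ (τ : Store) (t : ℕ),
    Run c (Store.init (encIn x)) τ t ∧ τ 0 = encOut (f x) ∧ t ≤ p.eval (encIn x).size

/-! ### Encodings -/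

def Literal.encode (a : Literal) : Data := .cons (.ofBool a.neg) (.binary a.var)

def Formula.encode : Formula → Data
  | bot => .cons (.unary 0) .nil
  | top => .cons (.unary 1) .nil
  | lit a => .cons (.unary 2) a.encode
  | and A B => .cons (.unary 3) (.cons A.encode B.encode)
  | or A B => .cons (.unary 4) (.cons A.encode B.encode)

def KSRule.encode : KSRule → Data
  | aid => .unary 0
  | awd => .unary 1
  | acd => .unary 2
  | switch => .unary 3
  | medial => .unary 4
  | eq => .unary 5

def Derivation.encode : Derivation → Data
  | formula A => .cons (.unary 0) A.encode
  | and Φ Ψ => .cons (.unary 1) (.cons Φ.encode Ψ.encode)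
  | or Φ Ψ => .cons (.unary 2) (.cons Φ.encode Ψ.encode)
  | step ρ Φ Ψ => .cons (.unary 3) (.cons ρ.encode (.cons Φ.encode Ψ.encode))

def Clause.encode (Γ : Clause) : Data := .ofList ((Γ.sort (· ≤ ·)).map Literal.encode)

def Reason.encode : Reason → Data
  | initial j => .cons (.unary 0) (.unary j)
  | wk i => .cons (.unary 1) (.unary i)
  | res i j a => .cons (.unary 2) (.cons (.unary i) (.cons (.unary j) a.encode))

def Line.encode (l : Line) : Data := .cons (Clause.encode l.clause) l.reason.encode

def ResDerivation.encode (π : ResDerivation) : Data :=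
  .cons (.ofList (π.initial.map Clause.encode)) (.ofList (π.lines.map Line.encode))

end DeepInf

namespace DeepInf

/-! ### Polynomial-time programs -/

/-! Resolution is read dually. Let `D` be the disjunction, over the initial clauses, of the
conjunctions of the duals of their members. A line with clause `Δ` becomes a derivation of `D` from
the conjunction of a list `l` of literals whose duals lie in `Δ`. The empty clause forces `l = []`,
so its derivation starts at `⊤` and is a proof of `D`.

An initial clause is one of the disjuncts of `D`, and the others are added by weakening
(`injDnf_derives`). A weakening step costs nothing, because `l` need not exhaust the clause. For
resolution on `a`, split the two lists into `P, U` and `Q, V`, where `U` collects the occurrences of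
the dual of `a` and `V` those of `a`. From a proof of `V ∨ U`, two switches lead from `P ∧ Q` to `(P
∧ U) ∨ (Q ∧ V)`; the two given derivations then yield `D ∨ D`, which contracts to `D`
(`cut_derives`, `resolve_refutes`).

`KS` has no rule that duplicates a conjunct, so lists are concatenated and a literal may occur in
`l` many times although the clause contains it once. Therefore `V ∨ U` has to be proved for repeated
literals, at cubic cost (`ident_derives`, `wsize_ident_le`). Since every translation is consumed at
most once, the lists alive at any moment have total length at most that of the clauses read so far,
and every step adds a polynomial amount to the total size (`total_listWeight_run_le`,
`total_wsize_next_le`). The pool enforces this single use by erasing what it hands out, so the size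
bounds hold for every input; tree-likeness enters only in correctness (`Pool.Correct.next`), where
it guarantees that the premisses are still in the pool.

For the running time, polynomial-time functions are closed under composition, pairing, case
distinction and recursion over lists with polynomially bounded values (`PolyTime.listRec`). The
required bounds are the same size estimates, with literals weighted by the length of their encoding.
-/

theorem eval_le_eval (p : Polynomial ℕ) {m n : ℕ} (h : m ≤ n) : p.eval m ≤ p.eval n := by
  rw [Polynomial.eval_eq_sum, Polynomial.eval_eq_sum]
  exact Finset.sum_le_sum fun k _ => Nat.mul_le_mul_left _ (Nat.pow_le_pow_left h k)

theorem Data.size_pos (d : Data) : 1 ≤ d.size := by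
  cases d <;> simp only [Data.size] <;> omega

/-- The program `c`, started in the memory `σ`, halts within time `T` in a memory satisfying
`Q`. -/
def Exec (c : Cmd) (σ : Store) (T : ℕ) (Q : Store → Prop) : Prop :=
  ∃ τ t, Run c σ τ t ∧ t ≤ T ∧ Q τ

namespace Exec

variable {c d : Cmd} {σ : Store} {S T : ℕ} {Q R : Store → Prop} {e : Exp}

theorem mono (h : Exec c σ S Q) (hST : S ≤ T) (hQR : ∀ τ, Q τ → R τ) : Exec c σ T R := by
  obtain ⟨τ, t, hr, ht, hq⟩ := h
  exact ⟨τ, t, hr, ht.trans hST, hQR τ hq⟩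

theorem skip (hQ : Q σ) : Exec .skip σ 1 Q := ⟨σ, 1, .skip σ, le_rfl, hQ⟩

theorem assign {x : ℕ} (hQ : Q (Function.update σ x (e.eval σ))) (hT : 1 + e.cost σ ≤ T) :
    Exec (.assign x e) σ T Q :=
  ⟨_, _, .assign x e σ, hT, hQ⟩

theorem seq (h : Exec c σ S fun τ => Exec d τ T Q) : Exec (.seq c d) σ (1 + S + T) Q := by
  obtain ⟨τ, s, hr, hs, υ, t, hr', ht, hq⟩ := h
  exact ⟨υ, _, .seq hr hr', by omega, hq⟩

theorem ite (h : if e.eval σ = .nil then Exec d σ T Q else Exec c σ T Q) :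
    Exec (.ite e c d) σ (1 + e.cost σ + T) Q := by
  split at h
  · obtain ⟨τ, t, hr, ht, hq⟩ := h
    exact ⟨τ, _, .iteFalse ‹_› hr, by omega, hq⟩
  · obtain ⟨τ, t, hr, ht, hq⟩ := h
    exact ⟨τ, _, .iteTrue ‹_› hr, by omega, hq⟩

theorem seq_of (hc : Exec c σ S R) (hd : ∀ τ, R τ → Exec d τ T Q) :
    Exec (.seq c d) σ (1 + S + T) Q :=
  seq (hc.mono le_rfl hd)

theorem assign_seq {x : ℕ} (h : Exec d (Function.update σ x (e.eval σ)) T Q)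
    (hS : e.cost σ ≤ S) : Exec (.seq (.assign x e) d) σ (2 + S + T) Q :=
  (seq (S := 1 + S) (assign h (by omega))).mono (by omega) fun _ h => h

/-- A loop that traverses the list in the variable `x`. -/
theorem whileList {γ : Type*} {enc : γ → Data} {x : ℕ} {B M : ℕ} {I : List γ → Store → Prop}
    (hx : ∀ l σ, I l σ → σ x = .ofList (l.map enc) ∧ (σ x).size ≤ M)
    (hc : ∀ b l σ, I (b :: l) σ → Exec c σ B (I l)) :
    ∀ (l : List γ) (σ : Store), I l σ →
      Exec (.while (.var x) c) σ ((l.length + 1) * (B + M + 2)) (I []) := by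
  intro l
  induction l with
  | nil =>
    intro σ hI
    obtain ⟨h1, h2⟩ := hx _ _ hI
    refine ⟨σ, _, .whileFalse ?_, ?_, hI⟩
    · simpa [Exp.eval, Data.ofList] using h1
    · simp only [Exp.cost, List.length_nil]; omega
  | cons b l ih =>
    intro σ hI
    obtain ⟨h1, h2⟩ := hx _ _ hI
    obtain ⟨τ, s, hr, hs, hI'⟩ := hc b l σ hI
    obtain ⟨υ, t, hr', ht, hI''⟩ := ih τ hI'
    refine ⟨υ, _, .whileTrue ?_ hr hr', ?_, hI''⟩
    · simp [Exp.eval, h1, Data.ofList]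
    · simp only [Exp.cost, List.length_cons]
      have : (l.length + 1 + 1) * (B + M + 2) = (l.length + 1) * (B + M + 2) + (B + M + 2) := by
        ring
      omega

/-- A program cannot write more than it is charged for. -/
theorem size_le (h : Exec c σ T Q) (x : ℕ) : ∃ τ, Q τ ∧ (τ x).size ≤ (σ x).size + T := by
  obtain ⟨τ, t, hr, ht, hq⟩ := h
  refine ⟨τ, hq, ?_⟩
  have key : ∀ (σ : Store) (e : Exp), (e.eval σ).size ≤ e.cost σ := by
    intro σ e
    induction e with
    | var x => simp [Exp.eval, Exp.cost]
    | nil => simp [Exp.eval, Exp.cost, Data.size]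
    | cons e f he hf => simp only [Exp.eval, Exp.cost, Data.size]; omega
    | hd e he =>
      simp only [Exp.eval, Exp.cost]
      cases h : e.eval σ <;> rw [h] at he <;> simp only [Data.hd, Data.size] at * <;> omega
    | tl e he =>
      simp only [Exp.eval, Exp.cost]
      cases h : e.eval σ <;> rw [h] at he <;> simp only [Data.tl, Data.size] at * <;> omega
    | eq e f he hf =>
      have := Data.size_pos (e.eval σ)
      have := Data.size_pos (f.eval σ)
      simp only [Exp.eval, Exp.cost]
      cases decide (e.eval σ = f.eval σ) <;> simp only [Data.ofBool, Data.size] <;> omega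
  refine le_trans ?_ (Nat.add_le_add_left ht _)
  clear ht hq
  induction hr with
  | skip σ => omega
  | assign y e σ =>
    by_cases h : x = y
    · subst h
      have := key σ e
      simp only [Function.update_self]; omega
    · simp only [Function.update_of_ne h]; omega
  | seq _ _ h1 h2 => omega
  | iteTrue _ _ h => omega
  | iteFalse _ _ h => omega
  | whileFalse _ => omega
  | whileTrue _ _ _ h1 h2 => omega

end Exec

/-- Some program computes `f a` from `i a` in polynomial time, whatever the other variables
hold, and it leaves all but finitely many variables untouched. -/
def Poly {α : Type*} (i f : α → Data) : Prop :=
  ∃ (c : Cmd) (N : ℕ) (p : Polynomial ℕ), ∀ (a : α) (σ : Store), σ 0 = i a →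
    Exec c σ (p.eval (i a).size) fun τ => τ 0 = f a ∧ ∀ x, N ≤ x → τ x = σ x

namespace Poly

variable {α β : Type*} {i f g h : α → Data}

theorem size_le (hf : Poly i f) :
    ∃ q : Polynomial ℕ, ∀ a, (f a).size ≤ q.eval (i a).size := by
  obtain ⟨c, N, p, hc⟩ := hf
  refine ⟨.X + p, fun a => ?_⟩
  -- Any memory with `i a` in variable `0` will do: the output is at most the input plus the running
  -- time.
  obtain ⟨τ, ⟨h1, -⟩, h2⟩ := (hc a (fun _ => i a) rfl).size_le 0
  simpa [h1] using h2

protected theorem id : Poly i i :=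
  ⟨.skip, 0, 1, fun a σ h => by simpa using Exec.skip (σ := σ) ⟨h, fun x => rfl⟩⟩

theorem comp (hf : Poly i f) (hg : Poly f g) : Poly i g := by
  obtain ⟨q, hq⟩ := hf.size_le
  obtain ⟨c, N, p, hc⟩ := hf
  obtain ⟨d, M, r, hd⟩ := hg
  refine ⟨.seq c d, max N M, 1 + p + r.comp q, fun a σ h => ?_⟩
  refine Exec.mono (Exec.seq_of (hc a σ h) (T := r.eval (f a).size)
    (Q := fun υ => υ 0 = g a ∧ ∀ x, max N M ≤ x → υ x = σ x)
    fun τ hτ => (hd a τ hτ.1).mono le_rfl fun υ hυ => ?_) ?_ fun _ h => h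
  · refine ⟨hυ.1, fun x hx => ?_⟩
    rw [hυ.2 x (le_of_max_le_right hx), hτ.2 x (le_of_max_le_left hx)]
  · have := eval_le_eval r (hq a)
    simp only [Polynomial.eval_add, Polynomial.eval_one, Polynomial.eval_comp]; omega

/-- Only the index type changes, not the program. With a subtype inclusion for `k`, this restricts a
program to the inputs that reach a branch. -/
theorem reindex (hf : Poly i f) (k : β → α) : Poly (fun b => i (k b)) (fun b => f (k b)) := by
  obtain ⟨c, N, p, hc⟩ := hf
  exact ⟨c, N, p, fun b σ h => hc (k b) σ h⟩

/-- Expressions that read only the variable `0`. -/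
theorem of_exp (e : Exp) (p : Polynomial ℕ)
    (he : ∀ a σ, σ 0 = i a → e.eval σ = f a ∧ e.cost σ ≤ p.eval (i a).size) : Poly i f := by
  refine ⟨.assign 0 e, 1, 1 + p, fun a σ h => Exec.assign ⟨?_, fun x hx => ?_⟩ ?_⟩
  · simp [he a σ h]
  · rw [Function.update_of_ne (by omega)]
  · simpa using (he a σ h).2

protected theorem const (d : Data) : Poly i fun _ => d := by
  have : ∃ (e : Exp) (n : ℕ), ∀ σ, e.eval σ = d ∧ e.cost σ ≤ n := by
    induction d with
    | nil => exact ⟨.nil, 1, fun σ => by simp [Exp.eval, Exp.cost]⟩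
    | cons d₁ d₂ h₁ h₂ =>
      obtain ⟨e₁, n₁, h₁⟩ := h₁
      obtain ⟨e₂, n₂, h₂⟩ := h₂
      refine ⟨.cons e₁ e₂, 1 + n₁ + n₂, fun σ => ?_⟩
      have := h₁ σ
      have := h₂ σ
      simp only [Exp.eval, Exp.cost, *, true_and]; omega
  obtain ⟨e, n, he⟩ := this
  exact of_exp e (.C n) fun a σ _ => by simpa using he σ

theorem hd (hf : Poly i f) : Poly i fun a => (f a).hd :=
  hf.comp <| of_exp (.hd (.var 0)) (.X + 2) fun a σ h => by
    simp [Exp.eval, Exp.cost, h]; omega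

theorem tl (hf : Poly i f) : Poly i fun a => (f a).tl :=
  hf.comp <| of_exp (.tl (.var 0)) (.X + 2) fun a σ h => by
    simp [Exp.eval, Exp.cost, h]; omega

protected theorem cons (hf : Poly i f) (hg : Poly i g) : Poly i fun a => .cons (f a) (g a) := by
  obtain ⟨q, hq⟩ := hf.size_le
  obtain ⟨q', hq'⟩ := hg.size_le
  obtain ⟨c, N, p, hc⟩ := hf
  obtain ⟨d, M, r, hd⟩ := hg
  -- `K` and `K + 1` lie beyond every variable that either subprogram alters; they keep the input
  -- and the first result.
  obtain ⟨K, hK⟩ : ∃ K, K = max N M + 1 := ⟨_, rfl⟩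
  refine ⟨.seq (.assign K (.var 0)) <| .seq c <| .seq (.assign (K + 1) (.var 0)) <|
    .seq (.assign 0 (.var K)) <| .seq d <| .assign 0 (.cons (.var (K + 1)) (.var 0)), K + 2,
    2 * .X + p + r + 2 * q + q' + 20, fun a σ h => ?_⟩
  have hq := hq a
  have hq' := hq' a
  refine Exec.mono (Exec.assign_seq (S := 1 + (i a).size) (Exec.seq_of (hc a _ ?_)
    (T := _) fun τ hτ =>
    Exec.assign_seq (S := 1 + (f a).size) (Exec.assign_seq (S := 1 + (i a).size)
      (Exec.seq_of (hd a _ ?_) (T := 4 + (f a).size + (g a).size) fun υ hυ => Exec.assign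
        (Q := fun τ => τ 0 = .cons (f a) (g a) ∧ ∀ x, K + 2 ≤ x → τ x = σ x) ⟨?_, ?_⟩ ?_)
      ?_) ?_) ?_) ?_ fun _ h => h
  · rw [Function.update_of_ne (by omega), h]
  · have := hτ.2 K (by omega)
    simp only [Function.update_self] at this
    simp [Exp.eval, this, h]
  · have := hυ.2 (K + 1) (by omega)
    simp [Exp.eval, hτ.1] at this
    simp [Exp.eval, this, hυ.1]
  · intro x hx
    have h1 := hυ.2 x (by omega)
    have h2 := hτ.2 x (by omega)
    simp only [Function.update_apply] at h1 h2 ⊢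
    simp only [show x ≠ 0 by omega, show x ≠ K by omega, show x ≠ K + 1 by omega,
      if_false] at *
    rw [h1, h2]
  · have := hυ.2 (K + 1) (by omega)
    simp [Exp.eval, hτ.1] at this
    simp [Exp.cost, this, hυ.1]; omega
  · have := hτ.2 K (by omega)
    simp only [Function.update_self] at this
    simp [Exp.cost, this, h, Exp.eval]
  · simp [Exp.cost, hτ.1]
  · simp [Exp.cost, h]
  · simp; omega

theorem eq (hf : Poly i f) (hg : Poly i g) : Poly i fun a => .ofBool (decide (f a = g a)) :=
  (hf.cons hg).comp <| of_exp (.eq (.hd (.var 0)) (.tl (.var 0))) (2 * .X + 10) fun a σ h => by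
    simp [Exp.eval, Exp.cost, h, Data.hd, Data.tl]; omega

/-- A test, where each branch need only work on the inputs that are sent to it. -/
theorem ite {P : α → Prop} [DecidablePred P] (ht : Poly i fun a => .ofBool (decide (P a)))
    (hf : Poly (fun a : {a // P a} => i a) fun a => f a)
    (hg : Poly (fun a : {a // ¬ P a} => i a) fun a => f a) : Poly i f := by
  obtain ⟨b, L, s, hb⟩ := ht
  obtain ⟨c, N, p, hc⟩ := hf
  obtain ⟨d, M, r, hd⟩ := hg
  -- `K` keeps the input while the test overwrites variable `0`.
  obtain ⟨K, hK⟩ : ∃ K, K = max L (max N M) + 1 := ⟨_, rfl⟩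
  refine ⟨.seq (.assign K (.var 0)) <| .seq b <| .ite (.var 0)
    (.seq (.assign 0 (.var K)) c) (.seq (.assign 0 (.var K)) d), K + 1,
    2 * .X + p + r + s + 20, fun a σ h => ?_⟩
  refine Exec.mono (Exec.assign_seq (S := 1 + (i a).size) (Exec.seq (hb a _ ?_ |>.mono le_rfl
    fun τ hτ => Exec.ite (T := 2 + (1 + (i a).size) + (p.eval (i a).size + r.eval (i a).size))
      (Q := fun τ => τ 0 = f a ∧ ∀ x, K + 1 ≤ x → τ x = σ x) ?_ |>.mono
      (T := 1 + 4 + 2 + (1 + (i a).size) + (p.eval (i a).size + r.eval (i a).size)) ?_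
        fun _ h => h)) ?_) ?_ fun _ h => h
  · rw [Function.update_of_ne (by omega), h]
  · have hτK := hτ.2 K (by omega)
    simp only [Function.update_self, Exp.eval, h] at hτK
    have hfr : ∀ x, K + 1 ≤ x → τ x = σ x := fun x hx => by
      rw [hτ.2 x (by omega), Function.update_of_ne (by omega)]
    simp only [Exp.eval, hτ.1]
    by_cases hP : P a
    · simp only [hP, decide_true, Data.ofBool, reduceCtorEq, if_false]
      refine Exec.assign_seq ((hc ⟨a, hP⟩ _ ?_).mono (Nat.le_add_right _ _)
        fun υ hυ => ⟨hυ.1, fun x hx => ?_⟩) ?_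
      · simp [Exp.eval, hτK]
      · rw [hυ.2 x (by omega), Function.update_of_ne (by omega), hfr x hx]
      · simp [Exp.cost, hτK]
    · simp only [hP, decide_false, Data.ofBool, if_true]
      refine Exec.assign_seq ((hd ⟨a, hP⟩ _ ?_).mono (Nat.le_add_left _ _)
        fun υ hυ => ⟨hυ.1, fun x hx => ?_⟩) ?_
      · simp [Exp.eval, hτK]
      · rw [hυ.2 x (by omega), Function.update_of_ne (by omega), hfr x hx]
      · simp [Exp.cost, hτK]
  · have : (τ 0).size ≤ 3 := by
      rw [hτ.1]; by_cases hP : P a <;> simp [hP, Data.ofBool, Data.size]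
    simp only [Exp.cost]; omega
  · simp [Exp.cost, h]
  · simp; omega

end Poly

/-! ### Standard encodings and closure properties of polynomial-time functions -/

/-- The standard encoding of a type. -/
class Enc (α : Type*) where
  enc : α → Data

open Enc

instance : Enc Data := ⟨fun d => d⟩

instance {α β : Type*} [Enc α] [Enc β] : Enc (α × β) := ⟨fun x => .cons (enc x.1) (enc x.2)⟩

instance {α : Type*} [Enc α] : Enc (List α) := ⟨fun l => .ofList (l.map enc)⟩

theorem enc_nil {α : Type*} [Enc α] : enc ([] : List α) = .nil := rfl

theorem enc_cons {α : Type*} [Enc α] (a : α) (l : List α) :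
    enc (a :: l) = .cons (enc a) (enc l) := rfl

theorem enc_pair {α β : Type*} [Enc α] [Enc β] (a : α) (b : β) :
    enc (a, b) = .cons (enc a) (enc b) := rfl

/-- Polynomial-time functions with respect to the standard encodings. -/
@[fun_prop]
def PolyTime {α β : Type*} [Enc α] [Enc β] (f : α → β) : Prop :=
  Poly (fun a => enc a) (fun a => enc (f a))

theorem length_le_size {α : Type*} [Enc α] (l : List α) : l.length + 1 ≤ (enc l).size := by
  induction l with
  | nil => simp [enc_nil, Data.size]
  | cons a l ih => simp only [enc_cons, Data.size, List.length_cons]; omega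

theorem size_enc_le_of_sublist {α : Type*} [Enc α] {l l' : List α} (h : l.Sublist l') :
    (enc l).size ≤ (enc l').size := by
  induction h with
  | slnil => exact le_rfl
  | cons a _ ih => simp only [enc_cons, Data.size]; omega
  | cons_cons a _ ih => simp only [enc_cons, Data.size]; omega

theorem size_enc_reverse {α : Type*} [Enc α] (l : List α) :
    (enc l.reverse).size = (enc l).size := by
  have key : ∀ l : List α, (enc l).size = (l.map fun a => (enc a).size + 1).sum + 1 := by
    intro l
    induction l with
    | nil => simp [enc_nil, Data.size]
    | cons a l ih => simp only [enc_cons, Data.size, ih, List.map_cons, List.sum_cons]; omega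
  rw [key, key, List.map_reverse, List.sum_reverse]

namespace PolyTime

variable {α β γ δ : Type*} [Enc α] [Enc β] [Enc γ] [Enc δ]

theorem size_le {f : α → β} (hf : PolyTime f) :
    ∃ q : Polynomial ℕ, ∀ a, (enc (f a)).size ≤ q.eval (enc a).size :=
  Poly.size_le hf

@[fun_prop]
theorem id : PolyTime fun a : α => a := Poly.id

@[fun_prop]
theorem comp {g : β → γ} {f : α → β} (hg : PolyTime g) (hf : PolyTime f) :
    PolyTime fun a => g (f a) :=
  Poly.comp hf (Poly.reindex hg f)

@[fun_prop]
theorem const (b : β) : PolyTime fun _ : α => b := Poly.const _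

@[fun_prop]
theorem pair {f : α → β} {g : α → γ} (hf : PolyTime f) (hg : PolyTime g) :
    PolyTime fun a => (f a, g a) :=
  Poly.cons hf hg

@[fun_prop]
theorem fst {f : α → β × γ} (hf : PolyTime f) : PolyTime fun a => (f a).1 := Poly.hd hf

@[fun_prop]
theorem snd {f : α → β × γ} (hf : PolyTime f) : PolyTime fun a => (f a).2 := Poly.tl hf

@[fun_prop]
theorem cons {f : α → β} {g : α → List β} (hf : PolyTime f) (hg : PolyTime g) :
    PolyTime fun a => f a :: g a :=
  Poly.cons hf hg

theorem ite {f g : α → β} {P : α → Prop} [DecidablePred P]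
    (ht : Poly (fun a => enc a) fun a => .ofBool (decide (P a)))
    (hf : PolyTime f) (hg : PolyTime g) : PolyTime fun a => if P a then f a else g a := by
  refine Poly.ite ht ?_ ?_
  · have h : ∀ a : {a // P a}, (if P a then f a else g a) = f a := fun a => if_pos a.2
    simpa only [h] using Poly.reindex hf (Subtype.val (p := P))
  · have h : ∀ a : {a // ¬ P a}, (if P a then f a else g a) = g a := fun a => if_neg a.2
    simpa only [h] using Poly.reindex hg (Subtype.val (p := fun a => ¬ P a))

theorem ite_eq {f g : α → β} {h k : α → γ} [DecidableEq β]
    (hinj : Function.Injective (enc : β → Data)) (hf : PolyTime f) (hg : PolyTime g)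
    (hh : PolyTime h) (hk : PolyTime k) : PolyTime fun a => if f a = g a then h a else k a := by
  refine ite ?_ hh hk
  simpa only [hinj.eq_iff] using Poly.eq hf hg

/-- Functions into lists, where the empty list and the other lists are treated separately. -/
theorem listCases {l : α → List β} {h : α → γ} {k : α × β × List β → γ} {f : α → γ}
    (hl : PolyTime l) (hh : PolyTime h) (hk : PolyTime k) (h0 : ∀ a, l a = [] → f a = h a)
    (h1 : ∀ a b t, l a = b :: t → f a = k (a, b, t)) : PolyTime f := by
  classical
  refine Poly.ite (P := fun a => l a = []) ?_ ?_ ?_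
  · have := Poly.eq hl (Poly.const (i := fun a => enc a) .nil)
    have h2 : ∀ a, (l a = []) ↔ enc (l a) = .nil := fun a => by
      cases l a <;> simp [enc_nil, enc_cons]
    simpa only [h2] using this
  · have h : ∀ a : {a // l a = []}, f a = h a := fun a => h0 a a.2
    simpa only [h] using Poly.reindex hh (Subtype.val (p := fun a => l a = []))
  · have h2 : ∀ a : {a // l a ≠ []}, ∃ p : β × List β, l a = p.1 :: p.2 := fun a => by
      obtain ⟨a, ha⟩ := a
      obtain ⟨b, t, h⟩ := List.exists_cons_of_ne_nil ha
      exact ⟨(b, t), h⟩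
    choose p hp using h2
    -- A nonempty list is encoded as the pair of its head and tail, so pairing the input with the
    -- list already gives the encoded triple.
    have h3 : Poly (fun a : {a // l a ≠ []} => enc a.1) fun a => enc (a.1, (p a).1, (p a).2) := by
      refine (Poly.cons Poly.id (Poly.reindex hl Subtype.val)).comp ?_
      simp only [hp, enc_pair, enc_cons]
      exact Poly.id
    have h4 := h3.comp (Poly.reindex hk fun a : {a // l a ≠ []} => (a.1, (p a).1, (p a).2))
    have h5 : ∀ a : {a // l a ≠ []}, f a = k (a, (p a).1, (p a).2) := fun a => h1 _ _ _ (hp a)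
    simpa only [h5] using h4

end PolyTime
end DeepInf

/-! ### Bounded recursion over lists -/

namespace DeepInf
open Enc
namespace PolyTime

variable {α β γ δ : Type*} [Enc α] [Enc β] [Enc γ] [Enc δ]

/-- A loop consumes the list from the front and accumulates `G` on the part already consumed, which
is in reverse order. The bound `q` is indispensable: iterating a polynomial-time step may produce
values of exponential size. -/
theorem listRec_reverse {G : α → List γ → β} {s : α × γ × List γ × β → β} (hs : PolyTime s)
    (h0 : PolyTime fun a => G a []) (hG : ∀ a c l, G a (c :: l) = s (a, c, l, G a l))
    (q : Polynomial ℕ) (hq : ∀ a l, (enc (G a l)).size ≤ q.eval (enc (a, l)).size) :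
    PolyTime fun x : α × List γ => G x.1 x.2.reverse := by
  obtain ⟨c, N, p, hc⟩ := h0
  obtain ⟨d, M, r, hd⟩ := hs
  obtain ⟨K, hK⟩ : ∃ K, K = max N M + 1 := ⟨_, rfl⟩
  -- `K` holds the parameter, `K + 1` the rest of the list, `K + 2` the value so far, and `K + 3`
  -- the consumed part, which the step function also reads.
  let body : Cmd := .seq (.assign 0 (.cons (.var K) (.cons (.hd (.var (K + 1)))
    (.cons (.var (K + 3)) (.var (K + 2)))))) <| .seq d <| .seq (.assign (K + 2) (.var 0)) <|
    .seq (.assign (K + 3) (.cons (.hd (.var (K + 1))) (.var (K + 3)))) <|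
    .assign (K + 1) (.tl (.var (K + 1)))
  let b : Polynomial ℕ := 60 + 10 * .X + 3 * q + r.comp (10 + 4 * .X + q)
  refine ⟨.seq (.assign (K + 1) (.tl (.var 0))) <| .seq (.assign 0 (.hd (.var 0))) <|
    .seq (.assign K (.var 0)) <| .seq c <| .seq (.assign (K + 2) (.var 0)) <|
    .seq (.assign (K + 3) .nil) <| .seq (.while (.var (K + 1)) body) <|
    .assign 0 (.var (K + 2)), K + 4, (.X + 1) * (b + .X + 2) + p + 10 * .X + 60 + 3 * q, ?_⟩
  rintro ⟨a, L⟩ σ h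
  set n := (enc (a, L)).size with hn
  have hn' : (enc a).size + (enc L).size + 1 = n := by
    rw [hn, enc_pair]; simp only [Data.size]; omega
  -- The consumed part is always a suffix of the reversed list, so all intermediate values are
  -- bounded in terms of the original input.
  have hGn : ∀ l, l <:+ L.reverse → (enc (G a l)).size ≤ q.eval n ∧ (enc l).size ≤ n := by
    intro l hl
    have hl' := size_enc_le_of_sublist hl.sublist
    rw [size_enc_reverse] at hl'
    refine ⟨(hq a l).trans (eval_le_eval _ ?_), by omega⟩
    rw [enc_pair]; simp only [Data.size]; omega
  let I : List γ → Store → Prop := fun rest τ => τ K = enc a ∧ τ (K + 1) = enc rest ∧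
    ∃ l, L.reverse = rest.reverse ++ l ∧ τ (K + 3) = enc l ∧ τ (K + 2) = enc (G a l) ∧
      ∀ x, K + 4 ≤ x → τ x = σ x
  have hI : ∀ l τ, I l τ → τ (K + 1) = .ofList (l.map enc) ∧ (τ (K + 1)).size ≤ n := by
    rintro l τ ⟨-, h1, l', h2, -⟩
    refine ⟨h1, ?_⟩
    rw [h1]
    have : l <:+: L := by
      rw [← List.reverse_infix, h2]; exact (List.prefix_append _ _).isInfix
    have := size_enc_le_of_sublist this.sublist
    omega
  have hbody : ∀ e l τ, I (e :: l) τ → Exec body τ (b.eval n) (I l) := by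
    rintro e l τ hτ
    have hsz := (hI _ _ hτ).2
    obtain ⟨h1, h2, l', h3, h4, h5, h6⟩ := hτ
    obtain ⟨hg, hl'⟩ := hGn l' ⟨_, h3.symm⟩
    rw [h2, enc_cons] at hsz
    rw [enc_cons] at h2
    simp only [Data.size] at hsz
    have hin : (enc (a, e, l', G a l')).size ≤ (10 + 4 * .X + q : Polynomial ℕ).eval n := by
      simp only [enc_pair, Data.size]; simp; omega
    refine Exec.mono (Exec.assign_seq (S := 10 + 3 * n + q.eval n) (Exec.seq_of
      (hd (a, e, l', G a l') _ ?_) (T := 20 + 5 * n + q.eval n) fun υ hυ =>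
      Exec.mono (Exec.assign_seq (S := 1 + q.eval n) (Exec.assign_seq (S := 5 + 2 * n)
        (Exec.assign (Q := I l) (T := 3 + n) ?_ ?_) ?_) ?_) ?_ fun _ h => h) ?_) ?_ fun _ h => h
    · simp [Exp.eval, h1, h2, h4, h5, enc_pair, Data.hd]
    · have e1 := hυ.2 K (by omega)
      have e2 := hυ.2 (K + 1) (by omega)
      have e3 := hυ.2 (K + 3) (by omega)
      simp only [Function.update_apply, show K ≠ 0 by omega, show K + 1 ≠ 0 by omega,
        show K + 3 ≠ 0 by omega, if_false] at e1 e2 e3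
      refine ⟨?_, ?_, e :: l', ?_, ?_, ?_, fun x hx => ?_⟩
      · simp [e1, h1]
      · simp [Exp.eval, e2, h2, Data.tl]
      · simp [h3]
      · simp [Exp.eval, e2, e3, h2, h4, Data.hd, enc_cons]
      · simp [Exp.eval, hυ.1, hG]
      · have e4 := hυ.2 x (by omega)
        simp only [Function.update_apply, show x ≠ 0 by omega, show x ≠ K + 1 by omega,
          show x ≠ K + 2 by omega, show x ≠ K + 3 by omega, if_false] at e4 ⊢
        rw [e4, h6 x hx]
    · have e2 := hυ.2 (K + 1) (by omega)
      simp only [Function.update_apply, show K + 1 ≠ 0 by omega, if_false] at e2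
      simp [Exp.cost, e2, h2, Data.size]; omega
    · have e2 := hυ.2 (K + 1) (by omega)
      have e3 := hυ.2 (K + 3) (by omega)
      simp only [Function.update_apply, show K + 1 ≠ 0 by omega, show K + 3 ≠ 0 by omega,
        if_false] at e2 e3
      simp [Exp.cost, e2, e3, h2, h4, Data.size]; omega
    · have := (hGn (e :: l') ⟨l.reverse, by simp [h3]⟩).1
      simp only [Exp.cost, hυ.1, ← hG]; omega
    · omega
    · simp [Exp.cost, h1, h2, h4, h5, Data.size]; omega
    · have := eval_le_eval r hin
      simp [b] at this ⊢; omega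
  refine Exec.mono (Exec.assign_seq (S := 2 + n) (Exec.assign_seq (S := 2 + n)
    (Exec.assign_seq (S := 1 + n) (Exec.seq_of (hc a _ ?_) (T := _) fun τ hτ =>
      Exec.assign_seq (S := 1 + q.eval n) (Exec.assign_seq (S := 1)
      (Exec.seq_of (Exec.whileList hI hbody L _ ?_) (T := 2 + q.eval n) fun υ hυ =>
      Exec.assign (Q := fun τ => τ 0 = enc (G a L.reverse) ∧ ∀ x, K + 4 ≤ x → τ x = σ x)
        ?_ ?_) ?_) ?_) ?_) ?_) ?_) ?_ fun _ h => h
  · simp [Function.update_apply, Exp.eval, h, enc_pair, Data.hd]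
  · have e1 := hτ.2 K (by omega)
    have e2 := hτ.2 (K + 1) (by omega)
    simp only [Function.update_apply, show K ≠ 0 by omega, show K + 1 ≠ 0 by omega,
        show K + 1 ≠ K by omega, if_false, if_true, Exp.eval, h, enc_pair, Data.tl, Data.hd,
        show 0 ≠ K + 1 by omega] at e1 e2
    refine ⟨?_, ?_, [], ?_, ?_, ?_, fun x hx => ?_⟩
    · simp [e1]
    · simp [e2]
    · simp
    · simp [Exp.eval, enc_nil]
    · simp [Exp.eval, hτ.1]
    · have e4 := hτ.2 x (by omega)
      simp only [Function.update_apply, show x ≠ 0 by omega, show x ≠ K by omega,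
        show x ≠ K + 1 by omega, show x ≠ K + 2 by omega, show x ≠ K + 3 by omega,
        if_false] at e4 ⊢
      exact e4
  · obtain ⟨-, -, l, h1, -, h2, h3⟩ := hυ
    obtain rfl : L.reverse = l := by simpa using h1
    refine ⟨by simp [Exp.eval, h2], fun x hx => ?_⟩
    rw [Function.update_of_ne (by omega), h3 x hx]
  · obtain ⟨-, -, l, h1, -, h2, h3⟩ := hυ
    obtain rfl : L.reverse = l := by simpa using h1
    have := (hGn L.reverse List.suffix_rfl).1
    simp only [Exp.cost, h2]; omega
  · simp [Exp.cost]
  · have := (hGn [] (List.nil_suffix)).1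
    simp only [Exp.cost, hτ.1]; omega
  · simp [Exp.eval, Exp.cost, h, enc_pair, Data.hd]; omega
  · simp only [Function.update_apply, Exp.cost, show 0 ≠ K + 1 by omega, if_false, h, ← hn]; omega
  · simp only [Exp.cost, h, ← hn]; omega
  · have e1 := length_le_size L
    have e2 := eval_le_eval p (show (enc a).size ≤ n by omega)
    have e3 := Nat.mul_le_mul_right (b.eval n + n + 2) (show L.length + 1 ≤ n + 1 by omega)
    simp only [Polynomial.eval_add, Polynomial.eval_mul, Polynomial.eval_X, Polynomial.eval_one,
      Polynomial.eval_ofNat]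
    omega

@[fun_prop]
-- The loop of `listRec_reverse`, with consing as its step, computes the reversal itself. Reversing
-- beforehand then gives recursion in the usual order.
theorem reverse {f : α → List γ} (hf : PolyTime f) : PolyTime fun a => (f a).reverse := by
  have h := listRec_reverse (α := List γ) (γ := γ) (β := List γ) (G := fun _ l => l)
    (s := fun p => p.2.1 :: p.2.2.2) (cons (fst (snd id)) (snd (snd (snd id)))) (const [])
    (fun _ _ _ => rfl) .X fun a l => by
      rw [enc_pair]; simp only [Data.size, Polynomial.eval_X]; omega
  exact h.comp (pair hf hf)

/-- Recursion over a list, with a polynomial bound for the size of the values. -/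
theorem listRec {G : α → List γ → β} {s : α × γ × List γ × β → β} {f : δ → α} {l : δ → List γ}
    (hs : PolyTime s) (h0 : PolyTime fun a => G a [])
    (hG : ∀ a c l, G a (c :: l) = s (a, c, l, G a l)) (q : Polynomial ℕ)
    (hq : ∀ a l, (enc (G a l)).size ≤ q.eval (enc (a, l)).size) (hf : PolyTime f)
    (hl : PolyTime l) : PolyTime fun x => G (f x) (l x) := by
  have := (listRec_reverse hs h0 hG q hq).comp (pair hf (reverse hl))
  simpa only [List.reverse_reverse] using this

end PolyTime
end DeepInf

namespace DeepInf

/-! ### Derivations in `KS` -/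

namespace Formula

def setoid : Setoid Formula := ⟨Equal, .refl, .symm, .trans⟩

namespace Equal

theorem orCongr {A B C D : Formula} (h : Equal A B) (h' : Equal C D) :
    Equal (or A C) (or B D) :=
  ((orComm A C).trans (ctxOr C h)).trans ((orComm C B).trans (ctxOr B h'))

theorem andCongr {A B C D : Formula} (h : Equal A B) (h' : Equal C D) :
    Equal (and A C) (and B D) :=
  ((andComm A C).trans (ctxAnd C h)).trans ((andComm C B).trans (ctxAnd B h'))

end Equal

/-- Formulae modulo `=`. -/
def Cls : Type := Quotient setoid

namespace Cls

def mk (A : Formula) : Cls := Quotient.mk setoid A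

def inf : Cls → Cls → Cls :=
  Quotient.map₂ (sa := setoid) (sb := setoid) (sc := setoid) and fun _ _ h _ _ h' =>
    Equal.andCongr h h'

def sup : Cls → Cls → Cls :=
  Quotient.map₂ (sa := setoid) (sb := setoid) (sc := setoid) or fun _ _ h _ _ h' =>
    Equal.orCongr h h'

/-- Instances of the rule `=` become equations in the quotient, where `ac_rfl` and rewriting with
the unit laws prove them. -/
theorem equal_iff {A B : Formula} : Equal A B ↔ mk A = mk B :=
  ⟨fun h => Quotient.sound (s := setoid) h, fun h => Quotient.exact (s := setoid) h⟩

theorem mk_and (A B : Formula) : mk (and A B) = inf (mk A) (mk B) := rfl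
theorem mk_or (A B : Formula) : mk (or A B) = sup (mk A) (mk B) := rfl

instance : Std.Commutative inf :=
  ⟨fun a b => Quotient.inductionOn₂ a b fun A B => equal_iff.1 (.andComm A B)⟩
instance : Std.Commutative sup :=
  ⟨fun a b => Quotient.inductionOn₂ a b fun A B => equal_iff.1 (.orComm A B)⟩
instance : Std.Associative inf :=
  ⟨fun a b c => Quotient.inductionOn₃ a b c fun A B C => equal_iff.1 (.andAssoc A B C)⟩
instance : Std.Associative sup :=
  ⟨fun a b c => Quotient.inductionOn₃ a b c fun A B C => equal_iff.1 (.orAssoc A B C)⟩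

theorem inf_top (a : Cls) : inf a (mk top) = a :=
  Quotient.inductionOn a fun A => equal_iff.1 (.andTop A)
theorem top_inf (a : Cls) : inf (mk top) a = a := by
  rw [Std.Commutative.comm (op := inf), inf_top]
theorem sup_bot (a : Cls) : sup a (mk bot) = a :=
  Quotient.inductionOn a fun A => equal_iff.1 (.orBot A)
theorem bot_sup (a : Cls) : sup (mk bot) a = a := by
  rw [Std.Commutative.comm (op := sup), sup_bot]
theorem sup_top_top : sup (mk top) (mk top) = mk top := equal_iff.1 .topTop
theorem inf_bot_bot : inf (mk bot) (mk bot) = mk bot := equal_iff.1 .botBot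

end Cls

/-! ### Conjunctions of literals and disjunctive normal forms -/

/-- The conjunction of a list of literals, ending in `⊤`. -/
def conj : List Literal → Formula
  | [] => top
  | a :: l => and (lit a) (conj l)

/-- The disjunction of the conjunctions of lists of literals, ending in `⊥`. -/
def dnf : List (List Literal) → Formula
  | [] => bot
  | l :: L => or (conj l) (dnf L)

theorem mk_conj_append (l m : List Literal) :
    Cls.mk (conj (l ++ m)) = Cls.inf (Cls.mk (conj l)) (Cls.mk (conj m)) := by
  induction l with
  | nil => simp [conj, Cls.top_inf]
  | cons a l ih => simp only [List.cons_append, conj, Cls.mk_and, ih]; ac_rfl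

/-- Splits off the occurrences of the literal resolved upon. They are kept with their multiplicity,
since the equations do not include idempotence. -/
theorem mk_conj_filter (l : List Literal) (b : Literal) :
    Cls.inf (Cls.mk (conj (l.filter fun x => x ≠ b))) (Cls.mk (conj (l.filter fun x => x = b))) =
      Cls.mk (conj l) := by
  induction l with
  | nil => simp [conj, Cls.top_inf]
  | cons a l ih =>
    by_cases h : a = b
    · simp only [h, ne_eq, not_true_eq_false, decide_false, Bool.false_eq_true, not_false_eq_true,
        List.filter_cons_of_neg, decide_true, List.filter_cons_of_pos, conj, Cls.mk_and, ← ih]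
      ac_rfl
    · simp only [h, ne_eq, not_false_eq_true, decide_true, List.filter_cons_of_pos, decide_false,
        Bool.false_eq_true, List.filter_cons_of_neg, conj, Cls.mk_and, ← ih]
      ac_rfl

theorem equal_bigAnd (l : List Literal) : Equal (conj l) (bigAnd (l.map lit)) := by
  induction l with
  | nil => exact .refl _
  | cons a l ih =>
    cases l with
    | nil => exact .andTop _
    | cons b l => exact .ctxAnd _ ih

/-- The closing units of `conj` and `dnf` make the recursions uniform; one final `=` step removes
them. -/
theorem equal_bigOr (L : List (List Literal)) :
    Equal (dnf L) (bigOr (L.map fun l => bigAnd (l.map lit))) := by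
  induction L with
  | nil => exact .refl _
  | cons l L ih =>
    cases L with
    | nil => exact (Equal.orBot _).trans (equal_bigAnd l)
    | cons m L => exact Equal.orCongr (equal_bigAnd l) ih

theorem dual_bigOr (l : List Formula) : (bigOr l).dual = bigAnd (l.map dual) := by
  induction l with
  | nil => rfl
  | cons A l ih =>
    cases l with
    | nil => rfl
    | cons B l => simp only [bigOr, dual, ih, List.map_cons, bigAnd]

theorem dual_bigAnd (l : List Formula) : (bigAnd l).dual = bigOr (l.map dual) := by
  induction l with
  | nil => rfl
  | cons A l ih =>
    cases l with
    | nil => rfl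
    | cons B l => simp only [bigOr, dual, ih, List.map_cons, bigAnd]

end Formula

open Formula

/-- The duals of the members of a clause. -/
def Clause.duals (Γ : Clause) : List Literal := (Γ.sort (· ≤ ·)).map Literal.dual

theorem Literal.dual_dual (a : Literal) : a.dual.dual = a := by
  simp [Literal.dual]

theorem Clause.mem_duals {Γ : Clause} {a : Literal} : a ∈ Γ.duals ↔ a.dual ∈ Γ := by
  simp only [Clause.duals, List.mem_map, Finset.mem_sort]
  constructor
  · rintro ⟨b, hb, rfl⟩
    rwa [Literal.dual_dual]
  · exact fun h => ⟨_, h, Literal.dual_dual a⟩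

/-- The dual of a formula in conjunctive normal form, from the duals of its clauses. -/
def dualCnf (L : List (List Literal)) : Formula := bigOr (L.map fun l => bigAnd (l.map lit))

theorem dual_cnf (Γs : List Clause) : (cnf Γs).dual = dualCnf (Γs.map Clause.duals) := by
  simp only [cnf, dualCnf, dual_bigAnd, List.map_map]
  congr 1
  refine List.map_congr_left fun Γ _ => ?_
  simp only [Function.comp, Clause.toFormula, dual_bigOr, Clause.duals, List.map_map]
  rfl

/-! ### Weakening, contraction, identity and cut as derivations -/

namespace Derivation

/-- `Φ` is a derivation with premiss `A` and conclusion `B`. -/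
def Derives (Φ : Derivation) (A B : Formula) : Prop := Φ.Valid ∧ Φ.pr = A ∧ Φ.cn = B

namespace Derives

variable {Φ Ψ : Derivation} {A B C D : Formula}

protected theorem formula (A : Formula) : Derives (formula A) A A := ⟨trivial, rfl, rfl⟩

protected theorem and (h : Derives Φ A B) (h' : Derives Ψ C D) :
    Derives (and Φ Ψ) (.and A C) (.and B D) :=
  ⟨⟨h.1, h'.1⟩, congrArg₂ _ h.2.1 h'.2.1, congrArg₂ _ h.2.2 h'.2.2⟩

protected theorem or (h : Derives Φ A B) (h' : Derives Ψ C D) :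
    Derives (or Φ Ψ) (.or A C) (.or B D) :=
  ⟨⟨h.1, h'.1⟩, congrArg₂ _ h.2.1 h'.2.1, congrArg₂ _ h.2.2 h'.2.2⟩

protected theorem step {ρ : KSRule} (h : Derives Φ A B) (hρ : ρ.Instance B C)
    (h' : Derives Ψ C D) : Derives (step ρ Φ Ψ) A D := by
  obtain ⟨h1, rfl, rfl⟩ := h
  obtain ⟨h1', rfl, rfl⟩ := h'
  exact ⟨⟨h1, h1', hρ⟩, rfl, rfl⟩

/-- A step by `=`, where the equality is checked modulo `=`. -/
theorem eq (h : Derives Φ A B) (hBC : Cls.mk B = Cls.mk C)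
    (h' : Derives Ψ C D) : Derives (step .eq Φ Ψ) A D :=
  h.step (.eq (Cls.equal_iff.2 hBC)) h'

end Derives

/-- From `⊥` to `⊤`. -/
def topOfBot : Derivation :=
  step .eq (formula .bot) <|
    step .medial (formula (.or (.and .bot .top) (.and .top .bot))) <|
      step .eq (formula (.and (.or .bot .top) (.or .top .bot))) (formula .top)

theorem topOfBot_derives : topOfBot.Derives .bot .top :=
  -- `⊥ = (⊥ ∧ ⊤) ∨ (⊤ ∧ ⊥) → (⊥ ∨ ⊤) ∧ (⊤ ∨ ⊥) = ⊤`. Medial is needed because the weakening rule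
  -- introduces literals only.
  (Derives.formula _).eq (by simp [Cls.mk_and, Cls.mk_or, Cls.inf_top, Cls.top_inf, Cls.sup_bot]) <|
    (Derives.formula _).step (.medial _ _ _ _) <|
      (Derives.formula _).eq
        (by simp [Cls.mk_and, Cls.mk_or, Cls.inf_top, Cls.bot_sup, Cls.sup_bot]) (.formula _)

def weakLit (a : Literal) : Derivation := step .awd (formula .bot) (formula (.lit a))

theorem weakLit_derives (a : Literal) : (weakLit a).Derives .bot (.lit a) :=
  (Derives.formula _).step (.awd a) (.formula _)

/-- From `⊥` to a conjunction of literals. -/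
def weakConj : List Literal → Derivation
  | [] => topOfBot
  | a :: l => step .eq (formula .bot) (and (weakLit a) (weakConj l))

theorem weakConj_derives : ∀ l, (weakConj l).Derives .bot (conj l)
  | [] => topOfBot_derives
  | a :: l => (Derives.formula _).eq (by simp [Cls.mk_and, Cls.inf_bot_bot])
      ((weakLit_derives a).and (weakConj_derives l))

/-- From `⊥` to a disjunctive normal form. -/
def weakDnf : List (List Literal) → Derivation
  | [] => formula .bot
  | l :: L => step .eq (formula .bot) (or (weakConj l) (weakDnf L))

theorem weakDnf_derives : ∀ L, (weakDnf L).Derives .bot (dnf L)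
  | [] => .formula _
  | l :: L => (Derives.formula _).eq (by simp [Cls.mk_or, Cls.sup_bot])
      ((weakConj_derives l).or (weakDnf_derives L))

/-- From one of its disjuncts to a disjunctive normal form. -/
def injDnf (m : List Literal) : List (List Literal) → Derivation
  | [] => formula (conj m)
  | l :: L =>
    if l = m then step .eq (formula (conj m)) (or (formula (conj m)) (weakDnf L))
    else step .eq (formula (conj m)) (or (weakConj l) (injDnf m L))

theorem injDnf_derives {m : List Literal} :
    ∀ {L : List (List Literal)}, m ∈ L → (injDnf m L).Derives (conj m) (dnf L)
  | l :: L, h => by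
    rw [injDnf]
    split_ifs with hl
    · subst hl
      exact (Derives.formula _).eq (by simp [Cls.mk_or, Cls.sup_bot])
        ((Derives.formula _).or (weakDnf_derives L))
    · exact (Derives.formula _).eq (by simp [Cls.mk_or, Cls.bot_sup]) ((weakConj_derives l).or
        (injDnf_derives ((List.mem_cons.1 h).resolve_left (Ne.symm hl))))

def contrLit (a : Literal) : Derivation :=
  step .acd (formula (.or (.lit a) (.lit a))) (formula (.lit a))

theorem contrLit_derives (a : Literal) :
    (contrLit a).Derives (.or (.lit a) (.lit a)) (.lit a) :=
  (Derives.formula _).step (.acd a) (.formula _)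

/-- Contraction of a conjunction of literals. -/
def contrConj : List Literal → Derivation
  | [] => step .eq (formula (.or .top .top)) (formula .top)
  | a :: l => step .medial (formula (.or (conj (a :: l)) (conj (a :: l))))
      (and (contrLit a) (contrConj l))

theorem contrConj_derives : ∀ l, (contrConj l).Derives (.or (conj l) (conj l)) (conj l)
  | [] => (Derives.formula _).eq Cls.sup_top_top (.formula _)
  -- Medial turns `(a ∧ C) ∨ (a ∧ C)` into `(a ∨ a) ∧ (C ∨ C)`, which reduces contraction to
  -- literals.
  | a :: l => (Derives.formula _).step (.medial _ _ _ _)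
      ((contrLit_derives a).and (contrConj_derives l))

/-- Contraction of a disjunctive normal form. -/
def contrDnf : List (List Literal) → Derivation
  | [] => step .eq (formula (.or .bot .bot)) (formula .bot)
  | l :: L => step .eq (formula (.or (dnf (l :: L)) (dnf (l :: L))))
      (or (contrConj l) (contrDnf L))

theorem contrDnf_derives : ∀ L, (contrDnf L).Derives (.or (dnf L) (dnf L)) (dnf L)
  | [] => (Derives.formula _).eq (Cls.sup_bot (Cls.mk .bot)) (.formula _)
  | l :: L => (Derives.formula _).eq (by simp only [dnf, Cls.mk_or]; ac_rfl)
      ((contrConj_derives l).or (contrDnf_derives L))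

/-- From proofs of `P ∨ X` and `Q ∨ X` and a contraction of `X` to a proof of `(P ∧ Q) ∨ X`. -/
def meet (P Q X : Formula) (Φ Ψ Ξ : Derivation) : Derivation :=
  step .eq (formula .top) <| step .switch (and Φ Ψ) <|
    step .eq (formula (.or (.and (.or P X) Q) X)) <|
      step .eq (or (step .switch (formula (.and Q (.or P X))) (formula (.or (.and Q P) X)))
        (formula X)) <| or (formula (.and P Q)) Ξ

theorem meet_derives {P Q X : Formula} {Φ Ψ Ξ : Derivation} (hΦ : Φ.Derives .top (.or P X))
    (hΨ : Ψ.Derives .top (.or Q X)) (hΞ : Ξ.Derives (.or X X) X) :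
    (meet P Q X Φ Ψ Ξ).Derives .top (.or (.and P Q) X) :=
  -- `(P ∨ X) ∧ (Q ∨ X) → ((P ∨ X) ∧ Q) ∨ X → ((Q ∧ P) ∨ X) ∨ X = (P ∧ Q) ∨ (X ∨ X)`, by two
  -- switches.
  (Derives.formula _).eq (by simp [Cls.mk_and, Cls.inf_top]) <|
    (hΦ.and hΨ).step (.switch _ _ _) <|
      (Derives.formula _).eq (by simp only [Cls.mk_and, Cls.mk_or]; ac_rfl) <|
        (((Derives.formula _).step (.switch _ _ _) (.formula _)).or (.formula X)).eq
          (by simp only [Cls.mk_and, Cls.mk_or]; ac_rfl) ((Derives.formula _).or hΞ)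

/-- The identity for a conjunction of occurrences of the dual of `b`. -/
def identLit (b : Literal) : List Literal → Derivation
  | [] => step .eq (formula .top) (or (formula .top) (weakLit b))
  | a :: l => meet (.lit a) (conj l) (.lit b)
      (step .aid (formula .top) (formula (.or (.lit a) (.lit b)))) (identLit b l) (contrLit b)

theorem identLit_derives {b : Literal} : ∀ {l : List Literal}, (∀ a ∈ l, b = a.dual) →
    (identLit b l).Derives .top (.or (conj l) (.lit b))
  | [], _ => (Derives.formula _).eq (by simp [Cls.mk_or, Cls.sup_bot])
      ((Derives.formula _).or (weakLit_derives b))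
  | a :: l, h => meet_derives ((Derives.formula _).step (by
        rw [h a List.mem_cons_self]; exact .aid a) (.formula _))
      (identLit_derives fun c hc => h c (List.mem_cons_of_mem _ hc)) (contrLit_derives b)

/-- The identity for a conjunction `l` of occurrences of a literal and a conjunction `m` of
occurrences of its dual. -/
def ident (l : List Literal) : List Literal → Derivation
  | [] => step .eq (formula .top) (or (formula .top) (weakConj l))
  | b :: m => meet (.lit b) (conj m) (conj l)
      (step .eq (identLit b l) (formula (.or (.lit b) (conj l)))) (ident l m) (contrConj l)

theorem ident_derives {l : List Literal} : ∀ {m : List Literal},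
    (∀ a ∈ l, ∀ b ∈ m, b = a.dual) → (ident l m).Derives .top (.or (conj m) (conj l))
  | [], _ => (Derives.formula _).eq (by simp [Cls.mk_or, Cls.sup_bot])
      ((Derives.formula _).or (weakConj_derives l))
  | b :: m, h => meet_derives
      ((identLit_derives fun a ha => h a ha b List.mem_cons_self).eq
        (by simp only [Cls.mk_or]; ac_rfl) (.formula _))
      (ident_derives fun a ha c hc => h a ha c (List.mem_cons_of_mem _ hc)) (contrConj_derives l)

/-- From `P ∧ Q` to the conclusion of a contraction `Θ`, via derivations `Ψ` from `P ∧ U` and `Ξ`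
from `Q ∧ V`, where `Φ` is a proof of `V ∨ U`. -/
def cut (R P Q U V : Formula) (Φ Ψ Ξ Θ : Derivation) : Derivation :=
  step .eq (formula R) <| step .eq (and (formula (.and P Q)) Φ) <|
    step .eq (and (formula P)
      (step .switch (formula (.and Q (.or V U))) (formula (.or (.and Q V) U)))) <|
    step .switch (formula (.and P (.or U (.and Q V)))) <|
      step .eq (formula (.or (.and P U) (.and Q V))) <| step .eq (or Ψ Ξ) Θ

theorem cut_derives {R P Q U V C D E : Formula} {Φ Ψ Ξ Θ : Derivation}
    (hR : Cls.mk R = Cls.inf (Cls.mk P) (Cls.mk Q)) (hC : Cls.mk C = Cls.inf (Cls.mk P) (Cls.mk U))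
    (hD : Cls.mk D = Cls.inf (Cls.mk Q) (Cls.mk V)) (hΦ : Φ.Derives .top (.or V U))
    (hΨ : Ψ.Derives C E) (hΞ : Ξ.Derives D E) (hΘ : Θ.Derives (.or E E) E) :
    (cut R P Q U V Φ Ψ Ξ Θ).Derives R E :=
  -- `P ∧ Q → P ∧ (Q ∧ (V ∨ U)) → P ∧ (U ∨ (Q ∧ V)) → (P ∧ U) ∨ (Q ∧ V) → E ∨ E → E`.
  (Derives.formula _).eq (by simp [Cls.mk_and, hR, Cls.inf_top]) <|
    ((Derives.formula _).and hΦ).eq (by simp only [Cls.mk_and, Cls.mk_or]; ac_rfl) <|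
    ((Derives.formula _).and ((Derives.formula _).step (.switch _ _ _) (.formula _))).eq
      (by simp only [Cls.mk_and, Cls.mk_or]; ac_rfl) <|
    (Derives.formula _).step (.switch _ _ _) <|
      (Derives.formula _).eq (by simp only [Cls.mk_and, Cls.mk_or, hC, hD]) <|
        (hΨ.or hΞ).eq rfl hΘ

/-- The simulation of a resolution step on `a`. -/
def resolve (L : List (List Literal)) (a : Literal) (x y : List Literal × Derivation) :
    List Literal × Derivation :=
  (x.1.filter (fun c => c ≠ a.dual) ++ y.1.filter (fun c => c ≠ a),
    cut (conj (x.1.filter (fun c => c ≠ a.dual) ++ y.1.filter (fun c => c ≠ a)))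
      (conj (x.1.filter fun c => c ≠ a.dual)) (conj (y.1.filter fun c => c ≠ a))
      (conj (x.1.filter fun c => c = a.dual)) (conj (y.1.filter fun c => c = a))
      (ident (x.1.filter fun c => c = a.dual) (y.1.filter fun c => c = a)) x.2 y.2 (contrDnf L))

/-- `x` consists of a list of duals of members of `Γ` and a derivation of a disjunctive normal form
from the conjunction of the list. -/
def Refutes (L : List (List Literal)) (Γ : Clause) (x : List Literal × Derivation) : Prop :=
  (∀ a ∈ x.1, a.dual ∈ Γ) ∧ x.2.Derives (conj x.1) (dnf L)

/-- All occurrences of the dual of `a` leave the first list and all occurrences of `a` leave the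
second, so the remaining members have their duals in `Γ` or `Δ`. If there are no such occurrences,
the corresponding conjunction is `⊤` and the same derivation works. -/
theorem resolve_refutes {L : List (List Literal)} {a : Literal} {C D E : Clause}
    {x y : List Literal × Derivation} (h : ResDerivation.ResStep a C D E) (hx : Refutes L C x)
    (hy : Refutes L D y) : Refutes L E (resolve L a x y) := by
  obtain ⟨Γ, Δ, rfl, rfl, rfl⟩ := h
  refine ⟨fun c hc => ?_, cut_derives ?_ (mk_conj_filter _ _).symm (mk_conj_filter _ _).symm
    (ident_derives fun c hc d hd => ?_) hx.2 hy.2 (contrDnf_derives L)⟩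
  · simp only [resolve, List.mem_append, List.mem_filter, decide_eq_true_eq] at hc
    rcases hc with ⟨hc, hca⟩ | ⟨hc, hca⟩
    · have := hx.1 c hc
      rw [Finset.mem_union, Finset.mem_singleton] at this
      refine Finset.mem_union_left _ (this.resolve_right fun h => hca ?_)
      rw [← h, Literal.dual_dual]
    · have := hy.1 c hc
      rw [Finset.mem_union, Finset.mem_singleton] at this
      refine Finset.mem_union_right _ (this.resolve_right fun h => hca ?_)
      rw [← Literal.dual_dual c, h, Literal.dual_dual]
  · exact mk_conj_append _ _
  · simp only [List.mem_filter, decide_eq_true_eq] at hc hd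
    rw [hc.2, hd.2, Literal.dual_dual]

end Derivation

open DeepInf.Derivation

/-! ### The translation -/

/-- The translations of those lines that have not been used yet, with their numbers. -/
abbrev Pool := List (ℕ × List Literal × Derivation)

namespace Pool

/-- The dummy value makes the translation total; its small size must be allowed for in the
estimates. -/
def find (S : Pool) (i : ℕ) : List Literal × Derivation :=
  ((S.filter fun e => e.1 = i).headD (0, [], .formula .top)).2

/-- Erasing after use prevents a translation from being copied, whether or not the input is
tree-like. -/
def erase (S : Pool) (i : ℕ) : Pool := S.filter fun e => e.1 ≠ i

/-- The pool after line `k`. -/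
def next (L : List (List Literal)) (k : ℕ) (S : Pool) (l : Line) : Pool :=
  match l.reason with
  | .initial _ => (k, l.clause.duals, injDnf l.clause.duals L) :: S
  | .wk i => (k, S.find i) :: S.erase i
  | .res i j a => (k, resolve L a (S.find i) ((S.erase i).find j)) :: (S.erase i).erase j

/-- The pool after the given lines, the last line first. -/
def run (L : List (List Literal)) : List Line → Pool
  | [] => []
  | l :: ls => next L ls.length (run L ls) l

end Pool

/-- The `KS` proof obtained from a Resolution refutation. -/
def ResDerivation.toKS (π : ResDerivation) : Derivation :=
  .step .eq (((Pool.run (π.initial.map Clause.duals) π.lines.reverse).headD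
    (0, [], .formula .top)).2.2) (.formula (dualCnf (π.initial.map Clause.duals)))

/-! ### Correctness of the translation -/

namespace Pool

theorem find_mem {S : Pool} {i : ℕ} (h : ∃ e ∈ S, e.1 = i) : (i, S.find i) ∈ S := by
  obtain ⟨e, he, hi⟩ := h
  have hmem : e ∈ S.filter fun e => e.1 = i := List.mem_filter.2 ⟨he, by simpa using hi⟩
  unfold find
  cases hl : S.filter fun e => e.1 = i with
  | nil => simp [hl] at hmem
  | cons d t =>
    have : d ∈ S.filter fun e => e.1 = i := by rw [hl]; exact List.mem_cons_self
    obtain ⟨h1, h2⟩ := List.mem_filter.1 this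
    have : d.1 = i := by simpa using h2
    subst this
    exact h1

theorem mem_erase {S : Pool} {i : ℕ} {e : ℕ × List Literal × Derivation} :
    e ∈ S.erase i ↔ e ∈ S ∧ e.1 ≠ i := by
  simp [erase]

/-- Every line before line `k` that has not been used has a correct translation in the pool. -/
def Correct (π : ResDerivation) (k : ℕ) (S : Pool) : Prop :=
  (∀ i < k, i ∉ ((π.lines.take k).flatMap fun l => l.reason.premisses) → ∃ e ∈ S, e.1 = i) ∧
    ∀ e ∈ S, ∃ l, π.lines[e.1]? = some l ∧
      Refutes (π.initial.map Clause.duals) l.clause e.2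

/-- By tree-likeness, no premiss of line `k` is a premiss of an earlier line, so its translation has
not yet been erased. -/
theorem Correct.next {π : ResDerivation} (hπ : π.IsDerivation) (ht : π.TreeLike) {k : ℕ}
    {S : Pool} {l : Line} (hl : π.lines[k]? = some l) (h : Correct π k S) :
    Correct π (k + 1) (next (π.initial.map Clause.duals) k S l) := by
  have hj := hπ k l hl
  have htake : π.lines.take (k + 1) = π.lines.take k ++ [l] := by
    rw [List.take_add_one, hl]; rfl
  have hnd : (((π.lines.take k).flatMap fun l => l.reason.premisses) ++
      l.reason.premisses).Nodup := by
    have h1 : ((π.lines.take (k + 1)).flatMap fun l => l.reason.premisses).Nodup := by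
      unfold ResDerivation.TreeLike at ht
      rw [← List.take_append_drop (k + 1) π.lines, List.flatMap_append] at ht
      exact ht.of_append_left
    simpa [htake] using h1
  rw [List.nodup_append] at hnd
  obtain ⟨-, hnd, hdisj⟩ := hnd
  obtain ⟨h1, h2⟩ := h
  have hout : ∀ {i : ℕ}, i ∈ l.reason.premisses →
      i ∉ ((π.lines.take k).flatMap fun l => l.reason.premisses) :=
    fun hi hi' => hdisj _ hi' _ hi rfl
  unfold Correct Pool.next
  simp only [htake, List.flatMap_append, List.mem_append, List.flatMap_cons, List.flatMap_nil,
    List.append_nil, not_or]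
  obtain ⟨E, r⟩ := l
  cases r with
  | initial j =>
    refine ⟨fun i hi hi' => ?_, fun e he => ?_⟩
    · rcases Nat.lt_succ_iff_lt_or_eq.1 hi with hi | rfl
      · obtain ⟨e, he, hei⟩ := h1 i hi hi'.1
        exact ⟨e, List.mem_cons_of_mem _ he, hei⟩
      · exact ⟨_, List.mem_cons_self, rfl⟩
    · rcases List.mem_cons.1 he with rfl | he
      · refine ⟨_, hl, fun a ha => Clause.mem_duals.1 ha, injDnf_derives ?_⟩
        exact List.mem_map_of_mem (List.mem_of_getElem? hj)
      · exact h2 e he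
  | wk p =>
    obtain ⟨hp, m, hm, Δ, hΔ⟩ := hj
    have hmem := find_mem (h1 p hp (hout (by simp [Reason.premisses])))
    refine ⟨fun i hi hi' => ?_, fun e he => ?_⟩
    · rcases Nat.lt_succ_iff_lt_or_eq.1 hi with hi | rfl
      · obtain ⟨e, he, hei⟩ := h1 i hi hi'.1
        refine ⟨e, List.mem_cons_of_mem _ (mem_erase.2 ⟨he, ?_⟩), hei⟩
        simpa [hei, Reason.premisses] using hi'.2
      · exact ⟨_, List.mem_cons_self, rfl⟩
    · rcases List.mem_cons.1 he with rfl | he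
      · obtain ⟨m', hm', hr⟩ := h2 _ hmem
        rw [hm] at hm'
        cases hm'
        refine ⟨_, hl, fun a ha => ?_, hr.2⟩
        change E = _ at hΔ
        subst hΔ
        exact Finset.mem_union_left _ (hr.1 a ha)
      · exact h2 e (mem_erase.1 he).1
  | res p q a =>
    obtain ⟨hp, hq, m, n, hm, hn, hres⟩ := hj
    -- The two premisses differ, so erasing the first leaves the second in the pool.
    have hpq : q ≠ p := by
      simp [Reason.premisses] at hnd; exact Ne.symm hnd
    have hmem := find_mem (h1 p hp (hout (by simp [Reason.premisses])))
    have hmem' : (q, (S.erase p).find q) ∈ S.erase p := by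
      obtain ⟨e, he, hei⟩ := h1 q hq (hout (by simp [Reason.premisses]))
      exact find_mem ⟨e, mem_erase.2 ⟨he, by rwa [hei]⟩, hei⟩
    refine ⟨fun i hi hi' => ?_, fun e he => ?_⟩
    · rcases Nat.lt_succ_iff_lt_or_eq.1 hi with hi | rfl
      · obtain ⟨e, he, hei⟩ := h1 i hi hi'.1
        have := hi'.2
        simp only [Reason.premisses, List.mem_cons, List.not_mem_nil, or_false, not_or] at this
        exact ⟨e, List.mem_cons_of_mem _ (mem_erase.2 ⟨mem_erase.2 ⟨he, by rw [hei]; exact this.1⟩,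
          by rw [hei]; exact this.2⟩), hei⟩
      · exact ⟨_, List.mem_cons_self, rfl⟩
    · rcases List.mem_cons.1 he with rfl | he
      · obtain ⟨m', hm', hr⟩ := h2 _ hmem
        rw [hm] at hm'
        cases hm'
        obtain ⟨n', hn', hr'⟩ := h2 _ (mem_erase.1 hmem').1
        rw [hn] at hn'
        cases hn'
        exact ⟨_, hl, resolve_refutes hres hr hr'⟩
      · exact h2 e (mem_erase.1 (mem_erase.1 he).1).1

theorem run_correct {π : ResDerivation} (hπ : π.IsDerivation) (ht : π.TreeLike) :
    ∀ k ≤ π.lines.length,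
      Correct π k (run (π.initial.map Clause.duals) (π.lines.take k).reverse) := by
  intro k
  induction k with
  | zero => exact fun _ => ⟨fun i hi => absurd hi (Nat.not_lt_zero i), by simp [run]⟩
  | succ k ih =>
    intro hk
    have hl : π.lines[k]? = some π.lines[k] := List.getElem?_eq_getElem hk
    have := (ih (by omega)).next hπ ht hl
    rw [List.take_add_one, hl]
    simp only [Option.toList_some, List.reverse_append, List.reverse_singleton,
      List.singleton_append, run, List.length_reverse, List.length_take]
    rwa [min_eq_left (by omega)]

theorem head_next (L : List (List Literal)) (k : ℕ) (S : Pool) (l : Line) :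
    ∃ x T, next L k S l = (k, x) :: T := by
  unfold next
  cases l.reason <;> exact ⟨_, _, rfl⟩

end Pool

theorem ResDerivation.toKS_proves {π : ResDerivation} (h : π.IsTreeLikeRefutation) :
    π.toKS.IsKSProofOf (cnf π.initial).dual := by
  obtain ⟨hπ, ⟨l, hl, hE⟩, ht⟩ := h
  have hlen : π.lines ≠ [] := by
    rintro h; simp [h] at hl
  have hc := Pool.run_correct hπ ht _ le_rfl
  rw [List.take_length] at hc
  rw [List.getLast?_eq_getElem?] at hl
  -- The head of the final pool is numbered by the last line, whose clause is empty.
  obtain ⟨x, T, hx⟩ : ∃ x T, Pool.run (π.initial.map Clause.duals) π.lines.reverse =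
      (π.lines.length - 1, x) :: T := by
    cases hr : π.lines.reverse with
    | nil => simp [hlen] at hr
    | cons m ls =>
      obtain ⟨x, T, hx⟩ := Pool.head_next (π.initial.map Clause.duals) ls.length
        (Pool.run (π.initial.map Clause.duals) ls) m
      have : π.lines.length - 1 = ls.length := by
        rw [← List.length_reverse, hr]; simp
      exact ⟨x, T, by rw [this]; exact hx⟩
  obtain ⟨m, hm, hr⟩ := hc.2 (π.lines.length - 1, x) (by rw [hx]; exact List.mem_cons_self)
  simp only [hl] at hm
  cases hm
  have hnil : x.1 = [] := List.eq_nil_iff_forall_not_mem.2 fun a ha => by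
    simpa [hE] using hr.1 a ha
  have hd := hr.2
  rw [hnil] at hd
  have : π.toKS.Derives .top (dualCnf (π.initial.map Clause.duals)) := by
    unfold ResDerivation.toKS
    rw [hx]
    exact hd.step (.eq (equal_bigOr _)) (.formula _)
  rwa [dual_cnf]

end DeepInf

namespace DeepInf
open Formula DeepInf.Derivation

/-! ### Size bounds

Sizes are measured relative to a weight of the literals, so that the bounds apply both to the
number of atom occurrences and to the size of the encodings. -/

/-- Every literal counts with its weight, and every other symbol counts `20`. -/
def Formula.wsize (w : Literal → ℕ) : Formula → ℕ
  | bot => 20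
  | top => 20
  | lit a => w a
  | and A B => 20 + A.wsize w + B.wsize w
  | or A B => 20 + A.wsize w + B.wsize w

def Derivation.wsize (w : Literal → ℕ) : Derivation → ℕ
  | formula A => 20 + A.wsize w
  | and Φ Ψ => 20 + Φ.wsize w + Ψ.wsize w
  | or Φ Ψ => 20 + Φ.wsize w + Ψ.wsize w
  | step _ Φ Ψ => 20 + Φ.wsize w + Ψ.wsize w

theorem Formula.size_le_wsize (A : Formula) : A.size ≤ A.wsize fun _ => 1 := by
  induction A <;> simp only [size, wsize] <;> omega

theorem Derivation.size_le_wsize (Φ : Derivation) : Φ.size ≤ Φ.wsize fun _ => 1 := by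
  induction Φ with
  | formula A => have := A.size_le_wsize; simp only [size, wsize]; omega
  | and Φ Ψ h h' => simp only [size, wsize]; omega
  | or Φ Ψ h h' => simp only [size, wsize]; omega
  | step ρ Φ Ψ h h' => simp only [size, wsize]; omega

section

variable (w : Literal → ℕ)

/-- The weight of a list of literals. -/
def listWeight (l : List Literal) : ℕ := (l.map fun a => w a + 20).sum

theorem listWeight_append (l m : List Literal) :
    listWeight w (l ++ m) = listWeight w l + listWeight w m := by
  simp [listWeight]

theorem listWeight_filter (p : Literal → Bool) (l : List Literal) :
    listWeight w (l.filter p) ≤ listWeight w l := by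
  induction l with
  | nil => simp
  | cons a l ih =>
    simp only [listWeight, List.filter_cons, List.map_cons, List.sum_cons] at *
    split
    · simp only [List.map_cons, List.sum_cons]; omega
    · omega

theorem wsize_conj (l : List Literal) : (conj l).wsize w = listWeight w l + 20 := by
  induction l with
  | nil => rfl
  | cons a l ih => simp only [conj, Formula.wsize, ih, listWeight, List.map_cons, List.sum_cons]; omega

theorem wsize_conj_cons (a : Literal) (l : List Literal) :
    (conj (a :: l)).wsize w = (conj l).wsize w + 20 + w a := by
  simp only [conj, Formula.wsize]; omega

theorem wsize_dnf_cons (l : List Literal) (L : List (List Literal)) :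
    (dnf (l :: L)).wsize w = (dnf L).wsize w + 20 + (conj l).wsize w := by
  simp only [dnf, Formula.wsize]; omega

theorem le_wsize_conj (l : List Literal) : 20 ≤ (conj l).wsize w := by
  rw [wsize_conj]; omega

theorem le_wsize_dnf (L : List (List Literal)) : 20 ≤ (dnf L).wsize w := by
  cases L <;> simp only [dnf, Formula.wsize] <;> omega

theorem wsize_bigAnd_le (l : List Literal) :
    (bigAnd (l.map lit)).wsize w ≤ (conj l).wsize w := by
  induction l with
  | nil => exact le_rfl
  | cons a l ih =>
    cases l with
    | nil => simp only [List.map, bigAnd, conj, Formula.wsize]; omega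
    | cons b l =>
      rw [wsize_conj_cons]
      simp only [List.map, bigAnd, Formula.wsize] at ih ⊢; omega

theorem wsize_dualCnf_le (L : List (List Literal)) :
    (dualCnf L).wsize w ≤ (dnf L).wsize w := by
  induction L with
  | nil => exact le_rfl
  | cons l L ih =>
    have := wsize_bigAnd_le w l
    rw [wsize_dnf_cons]
    cases L with
    | nil => simp only [dualCnf, List.map, bigOr]; omega
    | cons m L => simp only [dualCnf, List.map, bigOr, Formula.wsize] at ih ⊢; omega

theorem wsize_weakLit (a : Literal) : (weakLit a).wsize w = 80 + w a := by
  simp only [weakLit, Derivation.wsize, Formula.wsize]; omega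

theorem wsize_contrLit (a : Literal) : (contrLit a).wsize w = 80 + 3 * w a := by
  simp only [contrLit, Derivation.wsize, Formula.wsize]; omega

theorem wsize_weakConj_le (l : List Literal) :
    (weakConj l).wsize w ≤ 30 * (conj l).wsize w := by
  induction l with
  | nil => simp [weakConj, topOfBot, conj, Derivation.wsize, Formula.wsize]
  | cons a l ih =>
    rw [wsize_conj_cons]
    simp only [weakConj, Derivation.wsize, Formula.wsize, wsize_weakLit]; omega

theorem wsize_weakDnf_le (L : List (List Literal)) :
    (weakDnf L).wsize w ≤ 30 * (dnf L).wsize w := by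
  induction L with
  | nil => simp [weakDnf, dnf, Derivation.wsize, Formula.wsize]
  | cons l L ih =>
    have := wsize_weakConj_le w l
    rw [wsize_dnf_cons]
    simp only [weakDnf, Derivation.wsize, Formula.wsize]; omega

/-- Every disjunct that is passed over costs its own weakening and a fresh copy of `conj m`, hence
the product. -/
theorem wsize_injDnf_le (m : List Literal) (L : List (List Literal)) :
    (injDnf m L).wsize w ≤ (dnf L).wsize w * (130 + 2 * (conj m).wsize w) := by
  induction L with
  | nil => simp only [injDnf, dnf, Derivation.wsize, Formula.wsize]; omega
  | cons l L ih =>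
    have h1 := wsize_weakConj_le w l
    have h2 := wsize_weakDnf_le w L
    have h3 := le_wsize_conj w l
    have h4 := le_wsize_dnf w L
    rw [wsize_dnf_cons, injDnf]
    split_ifs <;> simp only [Derivation.wsize] <;> nlinarith

/-- Quadratic, because each medial step writes down two copies of the whole remaining conjunction.
-/
theorem wsize_contrConj_le (l : List Literal) :
    (contrConj l).wsize w ≤ 10 * (conj l).wsize w ^ 2 := by
  induction l with
  | nil => simp [contrConj, conj, Derivation.wsize, Formula.wsize]
  | cons a l ih =>
    have h3 := le_wsize_conj w l
    simp only [contrConj, Derivation.wsize, Formula.wsize, wsize_contrLit]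
    rw [wsize_conj_cons]
    nlinarith

theorem wsize_contrDnf_le (L : List (List Literal)) :
    (contrDnf L).wsize w ≤ 10 * (dnf L).wsize w ^ 2 := by
  induction L with
  | nil => simp [contrDnf, dnf, Derivation.wsize, Formula.wsize]
  | cons l L ih =>
    have h1 := wsize_contrConj_le w l
    have h3 := le_wsize_conj w l
    have h4 := le_wsize_dnf w L
    simp only [contrDnf, Derivation.wsize, Formula.wsize]
    rw [wsize_dnf_cons]
    nlinarith

theorem wsize_meet_le (P Q X : Formula) (Φ Ψ Ξ : Derivation) :
    (meet P Q X Φ Ψ Ξ).wsize w ≤ Φ.wsize w + Ψ.wsize w + Ξ.wsize w + 600 +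
      6 * (P.wsize w + Q.wsize w + X.wsize w) := by
  simp only [meet, Derivation.wsize, Formula.wsize]; omega

theorem wsize_identLit_le (b : Literal) (l : List Literal) :
    (identLit b l).wsize w ≤ 60 * ((conj l).wsize w * ((conj l).wsize w + w b)) := by
  induction l with
  | nil =>
    simp only [identLit, conj, Derivation.wsize, Formula.wsize, wsize_weakLit]; omega
  | cons a l ih =>
    have h3 := le_wsize_conj w l
    rw [identLit, wsize_conj_cons]
    refine (wsize_meet_le w _ _ _ _ _ _).trans ?_
    simp only [Derivation.wsize, Formula.wsize, wsize_contrLit]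
    nlinarith [Nat.zero_le (w a * w b), Nat.zero_le (w a * (conj l).wsize w)]

/-- Each member of `m` costs one `identLit` over `l` and one contraction of `conj l`, both
quadratic, besides linear copies of the formulae; summing over `m` gives a cubic bound. -/
theorem wsize_ident_le (l m : List Literal) :
    (ident l m).wsize w ≤
      200 * ((conj l).wsize w * (conj m).wsize w * ((conj l).wsize w + (conj m).wsize w)) := by
  induction m with
  | nil =>
    have h1 := wsize_weakConj_le w l
    have h3 := le_wsize_conj w l
    simp only [ident, conj, Derivation.wsize, Formula.wsize]
    nlinarith
  | cons b m ih =>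
    have h1 := wsize_identLit_le w b l
    have h2 := wsize_contrConj_le w l
    have h3 := le_wsize_conj w l
    have h4 := le_wsize_conj w m
    rw [ident, wsize_conj_cons]
    refine (wsize_meet_le w _ _ _ _ _ _).trans ?_
    simp only [Derivation.wsize, Formula.wsize]
    generalize (conj l).wsize w = x at *
    generalize (conj m).wsize w = y at *
    generalize w b = z at *
    -- The increment of the bound when `y` grows by `20 + z`; it has to pay for the new `meet`.
    have e : 200 * (x * (y + 20 + z) * (x + (y + 20 + z))) = 200 * (x * y * (x + y)) +
        200 * ((20 + z) * (x * (x + y + (y + 20 + z)))) := by ring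
    have e1 : 20 * (x + y + z) ≤ x * (x + y + (y + 20 + z)) := by nlinarith
    nlinarith [Nat.mul_le_mul_left z e1, Nat.mul_le_mul_left x h3, Nat.zero_le (x * y),
      Nat.zero_le (x * z)]

theorem wsize_cut_le (R P Q U V : Formula) (Φ Ψ Ξ Θ : Derivation) :
    (cut R P Q U V Φ Ψ Ξ Θ).wsize w ≤ Φ.wsize w + Ψ.wsize w + Ξ.wsize w + Θ.wsize w + 1000 +
      6 * (R.wsize w + P.wsize w + Q.wsize w + U.wsize w + V.wsize w) := by
  simp only [cut, Derivation.wsize, Formula.wsize]; omega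

theorem wsize_resolve_le (L : List (List Literal)) (a : Literal)
    (x y : List Literal × Derivation) :
    (resolve L a x y).2.wsize w ≤ x.2.wsize w + y.2.wsize w +
      (500 * (listWeight w x.1 + listWeight w y.1 + 40) ^ 3 + 10 * (dnf L).wsize w ^ 2) := by
  have h1 := wsize_ident_le w (x.1.filter fun c => c = a.dual) (y.1.filter fun c => c = a)
  have h2 := wsize_contrDnf_le w L
  have f1 := listWeight_filter w (fun c => c = a.dual) x.1
  have f2 := listWeight_filter w (fun c => c ≠ a.dual) x.1
  have f3 := listWeight_filter w (fun c => c = a) y.1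
  have f4 := listWeight_filter w (fun c => c ≠ a) y.1
  refine (wsize_cut_le w _ _ _ _ _ _ _ _ _).trans ?_
  simp only [wsize_conj, listWeight_append] at h1 ⊢
  obtain ⟨t, ht⟩ : ∃ t, t = listWeight w x.1 + listWeight w y.1 + 40 := ⟨_, rfl⟩
  have h3 : (ident (x.1.filter fun c => c = a.dual) (y.1.filter fun c => c = a)).wsize w ≤
      400 * t ^ 3 := by
    refine h1.trans ?_
    calc _ ≤ 200 * (t * t * (t + t)) := by gcongr <;> omega
      _ = 400 * t ^ 3 := by ring
  -- Since `t ≥ 40`, the copied formulae and constants, linear in `t`, fit into the `100 * t ^ 3`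
  -- left over by `h3`.
  have h4 : 1600 * t ≤ t ^ 3 := by
    have : 40 ≤ t := by omega
    calc 1600 * t = 40 * 40 * t := by ring
      _ ≤ t * t * t := by gcongr
      _ = t ^ 3 := by ring
  rw [← ht]
  omega

theorem listWeight_resolve_le (L : List (List Literal)) (a : Literal)
    (x y : List Literal × Derivation) :
    listWeight w (resolve L a x y).1 ≤ listWeight w x.1 + listWeight w y.1 := by
  have f2 := listWeight_filter w (fun c => c ≠ a.dual) x.1
  have f4 := listWeight_filter w (fun c => c ≠ a) y.1
  simp only [resolve, listWeight_append]
  omega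

end

/-! ### Size of the pool -/

namespace Pool

/-- The sum of a measure of the translations in the pool. -/
def total (g : List Literal × Derivation → ℕ) (S : Pool) : ℕ := (S.map fun e => g e.2).sum

theorem total_cons (g : List Literal × Derivation → ℕ) (e : ℕ × List Literal × Derivation)
    (S : Pool) : total g (e :: S) = g e.2 + total g S := by
  simp [total]

/-- Handing out a translation and erasing it conserves an additive measure, up to the dummy value
returned when the number is missing. This is where single use enters the bounds. -/
theorem total_erase_add_find_le (g : List Literal × Derivation → ℕ) (S : Pool) (i : ℕ) :
    total g (S.erase i) + g (S.find i) ≤ total g S + g ([], .formula .top) := by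
  have h1 : total g (S.erase i) + total g (S.filter fun e => e.1 = i) = total g S := by
    induction S with
    | nil => rfl
    | cons e S ih =>
      by_cases h : e.1 = i
      · simp [erase, h, total_cons] at ih ⊢; omega
      · simp [erase, h, total_cons] at ih ⊢; omega
  have h2 : g (S.find i) ≤ total g (S.filter fun e => e.1 = i) + g ([], .formula .top) := by
    unfold find
    cases S.filter fun e => e.1 = i with
    | nil => simp
    | cons e T => simp only [List.headD_cons, total_cons]; omega
  omega

variable (w : Literal → ℕ)

/-- Only initial lines create literals; weakening moves a list and resolution concatenates sublists
of two lists that leave the pool. -/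
theorem total_listWeight_run_le (L : List (List Literal)) (ls : List Line) :
    total (fun x => listWeight w x.1) (run L ls) ≤
      (ls.map fun l => listWeight w l.clause.duals).sum := by
  induction ls with
  | nil => simp [run, total]
  | cons l ls ih =>
    simp only [List.map_cons, List.sum_cons, run]
    refine le_trans ?_ (Nat.add_le_add_left ih _)
    generalize run L ls = S
    unfold next
    split
    · simp [total_cons]
    · rename_i i _
      have := total_erase_add_find_le (fun x => listWeight w x.1) S i
      simp only [total_cons, listWeight, List.map_nil, List.sum_nil] at this ⊢; omega
    · rename_i i j a _
      have h1 := total_erase_add_find_le (fun x => listWeight w x.1) S i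
      have h2 := total_erase_add_find_le (fun x => listWeight w x.1) (S.erase i) j
      have h3 := listWeight_resolve_le w L a (S.find i) ((S.erase i).find j)
      have h4 : listWeight w [] = 0 := rfl
      simp only [total_cons] at *; omega

/-- A bound for the growth of a pool in one step. -/
def growth (d n : ℕ) : ℕ := 80 + 500 * (n + 40) ^ 3 + 10 * d ^ 2 + d * (170 + 2 * n)

theorem growth_mono {d d' n n' : ℕ} (h : d ≤ d') (h' : n ≤ n') : growth d n ≤ growth d' n' := by
  unfold growth; gcongr

theorem total_wsize_next_le (L : List (List Literal)) (k : ℕ) (S : Pool) (l : Line) :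
    total (fun x => x.2.wsize w) (next L k S l) ≤ total (fun x => x.2.wsize w) S +
      growth ((dnf L).wsize w)
        (listWeight w l.clause.duals + total (fun x => listWeight w x.1) S) := by
  -- A resolution step may pick up two dummies of weight `40`, which explains the `80` in `growth`.
  have hd : (Derivation.formula .top).wsize w = 40 := rfl
  have hnil : listWeight w [] = 0 := rfl
  unfold next growth
  split
  · have := wsize_injDnf_le w l.clause.duals L
    rw [wsize_conj] at this
    have h := Nat.mul_le_mul_left ((dnf L).wsize w)
      (show 130 + 2 * (listWeight w l.clause.duals + 20) ≤
        170 + 2 * (listWeight w l.clause.duals + total (fun x => listWeight w x.1) S) by omega)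
    simp only [total_cons]; omega
  · rename_i i _
    have h1 := total_erase_add_find_le (fun x => x.2.wsize w) S i
    simp only [total_cons, hd] at *; omega
  · rename_i i j a _
    have h1 := total_erase_add_find_le (fun x => x.2.wsize w) S i
    have h2 := total_erase_add_find_le (fun x => x.2.wsize w) (S.erase i) j
    have h3 := wsize_resolve_le w L a (S.find i) ((S.erase i).find j)
    have h4 := total_erase_add_find_le (fun x => listWeight w x.1) S i
    have h5 := total_erase_add_find_le (fun x => listWeight w x.1) (S.erase i) j
    simp only [hd, hnil] at h1 h2 h4 h5
    have h6 : 500 * (listWeight w (S.find i).1 + listWeight w ((S.erase i).find j).1 + 40) ^ 3 ≤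
        500 * (listWeight w l.clause.duals + total (fun x => listWeight w x.1) S + 40) ^ 3 := by
      gcongr 500 * ?_ ^ 3
      omega
    simp only [total_cons]; omega

/-- The increments add up instead of compounding, because `growth` depends on the lists, already
bounded globally, and not on the derivations. -/
theorem total_wsize_run_le (L : List (List Literal)) (ls : List Line) :
    total (fun x => x.2.wsize w) (run L ls) ≤ ls.length *
      growth ((dnf L).wsize w) (ls.map fun l => listWeight w l.clause.duals).sum := by
  induction ls with
  | nil => simp [run, total]
  | cons l ls ih =>
    have h1 := total_wsize_next_le w L ls.length (run L ls) l
    have h2 := total_listWeight_run_le w L ls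
    simp only [List.map_cons, List.sum_cons, run, List.length_cons, Nat.succ_mul]
    refine h1.trans (Nat.add_le_add (ih.trans (Nat.mul_le_mul_left _ (growth_mono le_rfl ?_)))
      (growth_mono le_rfl ?_))
    · omega
    · omega

end Pool

namespace ResDerivation

theorem wsize_toKS_le (w : Literal → ℕ) (π : ResDerivation) :
    π.toKS.wsize w ≤ 80 + (dnf (π.initial.map Clause.duals)).wsize w + π.lines.length *
      Pool.growth ((dnf (π.initial.map Clause.duals)).wsize w)
        (π.lines.map fun l => listWeight w l.clause.duals).sum := by
  have h1 := Pool.total_wsize_run_le w (π.initial.map Clause.duals) π.lines.reverse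
  have h2 := wsize_dualCnf_le w (π.initial.map Clause.duals)
  rw [List.length_reverse, List.map_reverse, List.sum_reverse] at h1
  unfold toKS
  simp only [Derivation.wsize]
  cases hr : Pool.run (π.initial.map Clause.duals) π.lines.reverse with
  | nil => simp only [List.headD_nil, Derivation.wsize, Formula.wsize]; omega
  | cons e S =>
    rw [hr, Pool.total_cons] at h1
    simp only [List.headD_cons]; omega

theorem listWeight_duals_one (Γ : Clause) :
    listWeight (fun _ => 1) Γ.duals = 21 * Γ.card := by
  simp [listWeight, Clause.duals, mul_comm, Function.comp_def]

/-- The number of atom occurrences is polynomially bounded. -/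
theorem size_toKS_le : ∃ p : Polynomial ℕ, ∀ π : ResDerivation, π.toKS.size ≤ p.eval π.size := by
  -- This is the bound of `wsize_toKS_le` with `20 + 40 * X` for the weight of the `dnf` and `40 *
  -- X` for that of the lists.
  refine ⟨80 + (20 + 40 * .X) + .X * (80 + 500 * (40 * .X + 40) ^ 3 + 10 * (20 + 40 * .X) ^ 2 +
    (20 + 40 * .X) * (170 + 2 * (40 * .X))), fun π => ?_⟩
  have h1 : (dnf (π.initial.map Clause.duals)).wsize (fun _ => 1) ≤
      20 + 40 * (π.initial.map fun Γ => Γ.card + 1).sum := by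
    induction π.initial with
    | nil => exact le_rfl
    | cons Γ l ih =>
      simp only [List.map_cons, List.sum_cons, wsize_dnf_cons, wsize_conj,
        listWeight_duals_one] at *
      omega
  have h2 : (π.lines.map fun l => listWeight (fun _ => 1) l.clause.duals).sum ≤
      40 * (π.lines.map fun l => l.clause.card + 1).sum := by
    induction π.lines with
    | nil => exact le_rfl
    | cons Γ l ih =>
      simp only [List.map_cons, List.sum_cons, listWeight_duals_one] at *
      omega
  have h3 : π.lines.length ≤ (π.lines.map fun l => l.clause.card + 1).sum := by
    induction π.lines with
    | nil => exact le_rfl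
    | cons Γ l ih => simp only [List.map_cons, List.sum_cons, List.length_cons] at *; omega
  refine (π.toKS.size_le_wsize.trans (wsize_toKS_le _ π)).trans ?_
  have h4 : Pool.growth ((dnf (π.initial.map Clause.duals)).wsize fun _ => 1)
      (π.lines.map fun l => listWeight (fun _ => 1) l.clause.duals).sum ≤
      Pool.growth (20 + 40 * π.size) (40 * π.size) :=
    Pool.growth_mono (by unfold size; omega) (by unfold size; omega)
  have h5 := Nat.mul_le_mul (show π.lines.length ≤ π.size by unfold size; omega) h4
  have h6 : (dnf (π.initial.map Clause.duals)).wsize (fun _ => 1) ≤ 20 + 40 * π.size := by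
    unfold size; omega
  simp only [Polynomial.eval_add, Polynomial.eval_mul, Polynomial.eval_pow, Polynomial.eval_X,
    Polynomial.eval_ofNat]
  unfold Pool.growth at h5 ⊢
  omega

end ResDerivation
end DeepInf

namespace DeepInf
open Enc Formula DeepInf.Derivation

/-! ### The translation in polynomial time -/

instance : Enc ℕ := ⟨Data.unary⟩
instance : Enc Literal := ⟨Literal.encode⟩
instance : Enc Formula := ⟨Formula.encode⟩
instance : Enc Derivation := ⟨Derivation.encode⟩
instance : Enc (Finset Literal) := ⟨Clause.encode⟩
instance : Enc Reason := ⟨Reason.encode⟩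
instance : Enc Line := ⟨Line.encode⟩
instance : Enc ResDerivation := ⟨ResDerivation.encode⟩

theorem ofList_injective {l m : List Data} (h : Data.ofList l = .ofList m) : l = m := by
  induction l generalizing m with
  | nil => cases m <;> simp_all [Data.ofList]
  | cons a l ih =>
    cases m with
    | nil => simp [Data.ofList] at h
    | cons b m =>
      simp only [Data.ofList, Data.cons.injEq] at h
      rw [h.1, ih h.2]

/-- Programs test equality of trees; injective encodings turn this into a test of the encoded
objects. -/
theorem enc_list_injective {α : Type*} [Enc α] (h : Function.Injective (enc : α → Data)) :
    Function.Injective (enc : List α → Data) :=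
  fun _ _ hlm => List.map_injective_iff.2 h (ofList_injective hlm)

theorem enc_nat_injective : Function.Injective (enc : ℕ → Data) := fun m n h => by
  simpa using congrArg List.length (ofList_injective h)

theorem enc_literal_injective : Function.Injective (enc : Literal → Data) := by
  have hb : Function.Injective Data.ofBool := by
    intro b c h
    cases b <;> cases c <;> simp_all [Data.ofBool]
  rintro ⟨v, s⟩ ⟨v', s'⟩ h
  change Data.cons (.ofBool s) (.binary v) = .cons (.ofBool s') (.binary v') at h
  simp only [Data.cons.injEq] at h
  have h1 := List.map_injective_iff.2 hb (ofList_injective h.2)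
  have h2 : v = v' := by
    rw [← Nat.ofDigits_digits 2 v, ← Nat.ofDigits_digits 2 v', Nat.digits_two_eq_bits,
      Nat.digits_two_eq_bits, h1]
  rw [hb h.1, h2]

/-! ### Polynomial-time operations on syntax, numbers and lists -/

namespace PolyTime

variable {α β γ δ : Type*} [Enc α] [Enc β] [Enc γ] [Enc δ]

@[fun_prop]
theorem lit {f : α → Literal} (hf : PolyTime f) : PolyTime fun a => lit (f a) :=
  Poly.cons (Poly.const (.unary 2)) hf

@[fun_prop]
theorem and {f g : α → Formula} (hf : PolyTime f) (hg : PolyTime g) :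
    PolyTime fun a => Formula.and (f a) (g a) :=
  Poly.cons (Poly.const (.unary 3)) (Poly.cons hf hg)

@[fun_prop]
theorem or {f g : α → Formula} (hf : PolyTime f) (hg : PolyTime g) :
    PolyTime fun a => Formula.or (f a) (g a) :=
  Poly.cons (Poly.const (.unary 4)) (Poly.cons hf hg)

@[fun_prop]
theorem formula {f : α → Formula} (hf : PolyTime f) : PolyTime fun a => formula (f a) :=
  Poly.cons (Poly.const (.unary 0)) hf

@[fun_prop]
theorem derivation_and {f g : α → Derivation} (hf : PolyTime f) (hg : PolyTime g) :
    PolyTime fun a => Derivation.and (f a) (g a) :=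
  Poly.cons (Poly.const (.unary 1)) (Poly.cons hf hg)

@[fun_prop]
theorem derivation_or {f g : α → Derivation} (hf : PolyTime f) (hg : PolyTime g) :
    PolyTime fun a => Derivation.or (f a) (g a) :=
  Poly.cons (Poly.const (.unary 2)) (Poly.cons hf hg)

@[fun_prop]
theorem step {ρ : KSRule} {f g : α → Derivation} (hf : PolyTime f) (hg : PolyTime g) :
    PolyTime fun a => Derivation.step ρ (f a) (g a) :=
  Poly.cons (Poly.const (.unary 3)) (Poly.cons (Poly.const ρ.encode) (Poly.cons hf hg))

@[fun_prop]
theorem literal_dual {f : α → Literal} (hf : PolyTime f) : PolyTime fun a => (f a).dual := by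
  have h := Poly.cons (Poly.eq (Poly.hd hf) (Poly.const .nil)) (Poly.tl hf)
  have e : ∀ b : Literal, enc b.dual =
      .cons (.ofBool (decide ((enc b).hd = .nil))) (enc b).tl := by
    rintro ⟨v, s⟩
    cases s <;> rfl
  simpa only [PolyTime, e] using h

@[fun_prop]
theorem clause {f : α → Line} (hf : PolyTime f) : PolyTime fun a => (f a).clause := Poly.hd hf

theorem reason {f : α → Line} (hf : PolyTime f) : PolyTime fun a => (f a).reason := Poly.tl hf

theorem initial {f : α → ResDerivation} (hf : PolyTime f) : PolyTime fun a => (f a).initial :=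
  Poly.hd hf

theorem lines {f : α → ResDerivation} (hf : PolyTime f) : PolyTime fun a => (f a).lines :=
  Poly.tl hf

/-- A clause is encoded by its sorted list, so sorting requires no computation. -/
theorem sort {f : α → Clause} (hf : PolyTime f) : PolyTime fun a => (f a).sort (· ≤ ·) := hf

theorem reasonCases {r : α → Reason} {h : α → γ} {k : α × ℕ → γ} {m : α × ℕ × ℕ × Literal → γ}
    {f : α → γ} (hr : PolyTime r) (hh : PolyTime h) (hk : PolyTime k) (hm : PolyTime m)
    (h0 : ∀ a j, r a = .initial j → f a = h a) (h1 : ∀ a i, r a = .wk i → f a = k (a, i))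
    (h2 : ∀ a i j b, r a = .res i j b → f a = m (a, i, j, b)) : PolyTime f := by
  -- Once the tag is known, the tail of the encoded reason is the encoding of its arguments.
  have payload : ∀ {δ ε : Type _} [Enc ε] (g : δ → α) (x : δ → ε),
      (∀ d, (enc (r (g d))).tl = enc (x d)) →
        Poly (fun d => enc (g d)) fun d => enc (g d, x d) := by
    intro δ ε _ g x hx
    have := Poly.cons (Poly.id (i := fun d => enc (g d))) (Poly.reindex (Poly.tl hr) g)
    simp only [hx] at this
    exact this
  refine Poly.ite (P := fun a => (enc (r a)).hd = .unary 0)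
    (Poly.eq (Poly.hd hr) (Poly.const _)) ?_ ?_
  · have e : ∀ a : {a // (enc (r a)).hd = .unary 0}, f a = h a := by
      rintro ⟨a, ha⟩
      cases hra : r a with
      | initial j => exact h0 a j hra
      | wk i =>
        rw [hra] at ha
        exact absurd (show Data.unary 1 = .unary 0 from ha) (by decide)
      | res i j b =>
        rw [hra] at ha
        exact absurd (show Data.unary 2 = .unary 0 from ha) (by decide)
    simpa only [e] using Poly.reindex hh (Subtype.val (p := fun a => (enc (r a)).hd = .unary 0))
  refine Poly.ite (P := fun a : {a // ¬ (enc (r a)).hd = .unary 0} => (enc (r a)).hd = .unary 1)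
    (Poly.reindex (Poly.eq (Poly.hd hr) (Poly.const _)) Subtype.val) ?_ ?_
  · have e : ∀ a : {a : {a // ¬ (enc (r a)).hd = .unary 0} // (enc (r a)).hd = .unary 1},
        ∃ i, r a.1 = .wk i := by
      rintro ⟨⟨a, ha⟩, ha'⟩
      change (enc (r a)).hd = .unary 1 at ha'
      change ∃ i, r a = _
      cases hra : r a with
      | initial j =>
        rw [hra] at ha'
        exact absurd (show Data.unary 0 = .unary 1 from ha') (by decide)
      | wk i => exact ⟨i, rfl⟩
      | res i j b =>
        rw [hra] at ha'
        exact absurd (show Data.unary 2 = .unary 1 from ha') (by decide)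
    choose i hi using e
    have h3 := (payload (fun a => a.1.1) i fun a => by rw [hi]; rfl).comp
      (Poly.reindex hk fun a => (a.1.1, i a))
    have e' := fun a => h1 _ _ (hi a)
    simpa only [e'] using h3
  · have e : ∀ a : {a : {a // ¬ (enc (r a)).hd = .unary 0} // ¬ (enc (r a)).hd = .unary 1},
        ∃ x : ℕ × ℕ × Literal, r a.1 = .res x.1 x.2.1 x.2.2 := by
      rintro ⟨⟨a, ha⟩, ha'⟩
      change ¬ (enc (r a)).hd = .unary 1 at ha'
      change ∃ x : ℕ × ℕ × Literal, r a = _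
      cases hra : r a with
      | initial j => rw [hra] at ha; exact absurd rfl ha
      | wk i => rw [hra] at ha'; exact absurd rfl ha'
      | res i j b => exact ⟨(i, j, b), rfl⟩
    choose x hx using e
    have h3 := (payload (fun a => a.1.1) x fun a => by rw [hx]; rfl).comp
      (Poly.reindex hm fun a => (a.1.1, x a))
    have e' := fun a => h2 _ _ _ _ (hx a)
    simpa only [e'] using h3

@[fun_prop]
theorem succ {f : α → ℕ} (hf : PolyTime f) : PolyTime fun a => f a + 1 :=
  Poly.cons (Poly.const .nil) hf

@[fun_prop]
theorem length {l : α → List γ} (hl : PolyTime l) : PolyTime fun a => (l a).length := by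
  refine listRec (G := fun (_ : Data) (l : List γ) => l.length) (f := fun _ => .nil)
    (s := fun p => p.2.2.2 + 1) (by fun_prop) (by fun_prop) (fun _ _ _ => rfl) (2 * .X)
    (fun a l => ?_) (by fun_prop) hl
  have := length_le_size l
  have e : ∀ n : ℕ, (enc n).size = 2 * n + 1 := fun n => by
    induction n with
    | zero => rfl
    | succ n ih => change 1 + 1 + (enc n).size = _; omega
  rw [e, enc_pair]; simp [Data.size]; omega

@[fun_prop]
theorem append {f g : α → List γ} (hf : PolyTime f) (hg : PolyTime g) :
    PolyTime fun a => f a ++ g a := by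
  refine listRec (G := fun (m l : List γ) => l ++ m) (s := fun p => p.2.1 :: p.2.2.2)
    (by fun_prop) (by simpa using id) (fun _ _ _ => rfl) .X (fun m l => ?_) hg hf
  rw [enc_pair]
  induction l with
  | nil => simp [Data.size]; omega
  | cons a l ih =>
    simp only [List.cons_append, enc_cons, Data.size, Polynomial.eval_X] at ih ⊢; omega

@[fun_prop]
theorem headD {l : α → List γ} {d : γ} (hl : PolyTime l) : PolyTime fun a => (l a).headD d :=
  listCases (h := fun _ => d) (k := fun p => p.2.1) hl (by fun_prop) (by fun_prop)
    (fun a h => by simp [h]) (fun a b t h => by simp [h])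

theorem filter_eq [DecidableEq δ] (hinj : Function.Injective (enc : δ → Data)) {κ : γ → δ}
    (hκ : PolyTime κ) {l : α → List γ} {b : α → δ} (hl : PolyTime l) (hb : PolyTime b) :
    PolyTime fun a => (l a).filter fun c => κ c = b a := by
  refine listRec (G := fun (b : δ) (l : List γ) => l.filter fun c => κ c = b)
    (s := fun p => if κ p.2.1 = p.1 then p.2.1 :: p.2.2.2 else p.2.2.2)
    (ite_eq hinj (by fun_prop) (by fun_prop) (by fun_prop) (by fun_prop)) (by simpa using const _)
    (fun _ _ _ => by simp [List.filter_cons]) .X (fun m l => ?_) hb hl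
  have := size_enc_le_of_sublist (List.filter_sublist (l := l) (p := fun c => κ c = m))
  rw [enc_pair]; simp only [Data.size, Polynomial.eval_X]; omega

theorem filter_ne [DecidableEq δ] (hinj : Function.Injective (enc : δ → Data)) {κ : γ → δ}
    (hκ : PolyTime κ) {l : α → List γ} {b : α → δ} (hl : PolyTime l) (hb : PolyTime b) :
    PolyTime fun a => (l a).filter fun c => κ c ≠ b a := by
  refine listRec (G := fun (b : δ) (l : List γ) => l.filter fun c => κ c ≠ b)
    (s := fun p => if κ p.2.1 = p.1 then p.2.2.2 else p.2.1 :: p.2.2.2)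
    (ite_eq hinj (by fun_prop) (by fun_prop) (by fun_prop) (by fun_prop)) (by simpa using const _)
    (fun _ _ _ => by simp [List.filter_cons]) .X (fun m l => ?_) hb hl
  have := size_enc_le_of_sublist (List.filter_sublist (l := l) (p := fun c => κ c ≠ m))
  rw [enc_pair]; simp only [Data.size, Polynomial.eval_X]; omega

theorem map {h : γ → δ} (hh : PolyTime h) {l : α → List γ} (hl : PolyTime l) :
    PolyTime fun a => (l a).map h := by
  obtain ⟨q, hq⟩ := hh.size_le
  refine listRec (G := fun (_ : Data) (l : List γ) => l.map h) (f := fun _ => .nil)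
    (s := fun p => h p.2.1 :: p.2.2.2) (by fun_prop) (by simpa using const _) (fun _ _ _ => rfl)
    (.X * (q + 1)) (fun a l => ?_) (by fun_prop) hl
  obtain ⟨n, hn⟩ : ∃ n, n = (enc (a, l)).size := ⟨_, rfl⟩
  have hn' : (enc l).size ≤ n := by rw [hn, enc_pair]; simp only [Data.size]; omega
  have key : (enc (l.map h)).size ≤ (l.length + 1) * (q.eval n + 1) := by
    clear hn
    induction l with
    | nil => simp [enc_nil, Data.size]
    | cons c l ih =>
      simp only [enc_cons, Data.size] at hn'
      have h1 := ih (by omega)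
      have h2 := (hq c).trans (eval_le_eval q (show (enc c).size ≤ n by omega))
      simp only [List.map_cons, enc_cons, Data.size, List.length_cons, Nat.succ_mul] at *
      omega
  refine key.trans ?_
  rw [← hn]
  simp only [Polynomial.eval_mul, Polynomial.eval_add, Polynomial.eval_X, Polynomial.eval_one]
  exact Nat.mul_le_mul_right _ ((length_le_size l).trans hn')

end PolyTime
end DeepInf

/-! ### Weights compared with sizes of encodings -/

namespace DeepInf
open Enc Formula DeepInf.Derivation

/-- A weight that bounds the size of the encoding of a literal. -/
def encWeight (a : Literal) : ℕ := (Data.binary a.var).size + 20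

/-- The slack of `6` pays for the tag that makes a literal a formula; the lower bound serves to
estimate weights by input size. -/
theorem Literal.size_enc (a : Literal) :
    (Data.binary a.var).size + 2 ≤ (enc a).size ∧ (enc a).size + 6 ≤ encWeight a := by
  obtain ⟨v, s⟩ := a
  change _ ≤ 1 + (Data.ofBool s).size + (Data.binary v).size ∧
    1 + (Data.ofBool s).size + (Data.binary v).size + 6 ≤ (Data.binary v).size + 20
  cases s <;> simp only [Data.ofBool, Data.size] <;> omega

theorem Formula.size_enc_le (A : Formula) : (enc A).size ≤ A.wsize encWeight := by
  change A.encode.size ≤ _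
  have h : ∀ a : Literal, a.encode.size + 6 ≤ encWeight a := fun a => a.size_enc.2
  induction A with
  | lit a =>
    have := h a
    simp only [Formula.encode, Data.unary, Data.ofList, Data.size, Formula.wsize,
      List.replicate]; omega
  | _ =>
    simp only [Formula.encode, Data.unary, Data.ofList, Data.size, Formula.wsize,
      List.replicate]; omega

theorem Derivation.size_enc_le (Φ : Derivation) : (enc Φ).size ≤ Φ.wsize encWeight := by
  -- A step can have an overhead of `21`, one more than the allowance of `20`; the extra `1` from
  -- each of the two subderivations covers it.
  suffices Φ.encode.size + 1 ≤ Φ.wsize encWeight from (Nat.le_succ _).trans this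
  have h : ∀ A : Formula, A.encode.size ≤ A.wsize encWeight := Formula.size_enc_le
  have h' : ∀ ρ : KSRule, ρ.encode.size ≤ 11 := fun ρ => by
    cases ρ <;>
      simp only [KSRule.encode, Data.unary, Data.ofList, Data.size, List.replicate] <;> omega
  induction Φ with
  | formula A =>
    have := h A
    simp only [Derivation.encode, Data.unary, Data.ofList, Data.size, Derivation.wsize,
      List.replicate]; omega
  | step ρ Φ Ψ =>
    have := h' ρ
    simp only [Derivation.encode, Data.unary, Data.ofList, Data.size, Derivation.wsize,
      List.replicate]; omega
  | _ =>
    simp only [Derivation.encode, Data.unary, Data.ofList, Data.size, Derivation.wsize,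
      List.replicate]; omega

theorem encWeight_le (a : Literal) : encWeight a ≤ 20 * (enc a).size := by
  have := a.size_enc.1
  unfold encWeight
  omega

theorem wsize_conj_le_size (l : List Literal) :
    (conj l).wsize encWeight ≤ 40 * (enc l).size := by
  induction l with
  | nil => simp [conj, Formula.wsize, enc_nil, Data.size]
  | cons a l ih =>
    have := encWeight_le a
    rw [wsize_conj_cons, enc_cons]
    simp only [Data.size]; omega

theorem wsize_dnf_le_size (L : List (List Literal)) :
    (dnf L).wsize encWeight ≤ 40 * (enc L).size := by
  induction L with
  | nil => simp [dnf, Formula.wsize, enc_nil, Data.size]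
  | cons l L ih =>
    have := wsize_conj_le_size l
    rw [wsize_dnf_cons, enc_cons]
    simp only [Data.size]; omega

theorem size_enc_add_le {α β : Type*} [Enc α] [Enc β] (a : α) (b : β) :
    (enc a).size + (enc b).size + 1 ≤ (enc (a, b)).size := by
  rw [enc_pair]; simp only [Data.size]; omega

theorem wsize_conj_le_pair {α : Type*} [Enc α] (a : α) (l : List Literal) :
    (conj l).wsize encWeight ≤ 40 * (enc (a, l)).size := by
  have := wsize_conj_le_size l
  have := size_enc_add_le a l
  omega

theorem wsize_dnf_le_pair {α : Type*} [Enc α] (a : α) (L : List (List Literal)) :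
    (dnf L).wsize encWeight ≤ 40 * (enc (a, L)).size := by
  have := wsize_dnf_le_size L
  have := size_enc_add_le a L
  omega

/-- A bound for `Φ` gives one for its encoding. -/
theorem size_enc_le_eval {Φ : Derivation} {b : ℕ} {q : Polynomial ℕ} {n : ℕ}
    (h : Φ.wsize encWeight ≤ b) (hb : b ≤ q.eval n) : (enc Φ).size ≤ q.eval n :=
  Φ.size_enc_le.trans (h.trans hb)

/-! ### Programs for the building blocks of the translation -/

namespace PolyTime

variable {α : Type*} [Enc α]

@[fun_prop]
theorem conj {l : α → List Literal} (hl : PolyTime l) : PolyTime fun a => conj (l a) := by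
  refine listRec (G := fun (_ : Data) l => Formula.conj l) (f := fun _ => .nil)
    (s := fun p => .and (.lit p.2.1) p.2.2.2) (by fun_prop) (const _)
    (fun _ _ _ => rfl) (40 * .X) (fun a l => ?_) (const _) hl
  simpa using (Formula.size_enc_le _).trans (wsize_conj_le_pair a l)

@[fun_prop]
theorem dnf {L : α → List (List Literal)} (hL : PolyTime L) : PolyTime fun a => dnf (L a) := by
  refine listRec (G := fun (_ : Data) L => Formula.dnf L) (f := fun _ => .nil)
    (s := fun p => .or (Formula.conj p.2.1) p.2.2.2) (by fun_prop) (const _)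
    (fun _ _ _ => rfl) (40 * .X) (fun a l => ?_) (const _) hL
  simpa using (Formula.size_enc_le _).trans (wsize_dnf_le_pair a l)

@[fun_prop]
theorem bigOr {l : α → List Formula} (hl : PolyTime l) : PolyTime fun a => bigOr (l a) := by
  refine listRec (G := fun (_ : Data) l => Formula.bigOr l) (f := fun _ => .nil)
    -- The step must inspect the tail, since `bigOr` appends no `⊥` to a nonempty list.
    (s := fun p => match p.2.2.1 with | [] => p.2.1 | _ :: _ => .or p.2.1 p.2.2.2)
    (listCases (l := fun p => p.2.2.1) (h := fun p => p.2.1) (k := fun p => .or p.1.2.1 p.1.2.2.2)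
      (by fun_prop) (by fun_prop) (by fun_prop) (fun _ h => by simp only [h])
      (fun _ _ _ h => by simp only [h])) (const _)
    (fun _ _ l => by cases l <;> rfl) (20 * .X) (fun a l => ?_) (const _) hl
  have h1 : (enc (Formula.bigOr l)).size ≤ 20 * (enc l).size := by
    induction l with
    | nil => decide
    | cons A l ih =>
      cases l with
      | nil => simp only [Formula.bigOr, enc_cons, Data.size]; omega
      | cons B l =>
        change 1 + (Data.unary 4).size + (1 + (enc A).size + (enc (Formula.bigOr (B :: l))).size) ≤
          20 * (1 + (enc A).size + (enc (B :: l)).size)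
        have : (Data.unary 4).size = 9 := rfl
        omega
  have := size_enc_add_le a l
  simp; omega

@[fun_prop]
theorem bigAnd {l : α → List Formula} (hl : PolyTime l) : PolyTime fun a => bigAnd (l a) := by
  refine listRec (G := fun (_ : Data) l => Formula.bigAnd l) (f := fun _ => .nil)
    (s := fun p => match p.2.2.1 with | [] => p.2.1 | _ :: _ => .and p.2.1 p.2.2.2)
    (listCases (l := fun p => p.2.2.1) (h := fun p => p.2.1) (k := fun p => .and p.1.2.1 p.1.2.2.2)
      (by fun_prop) (by fun_prop) (by fun_prop) (fun _ h => by simp only [h])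
      (fun _ _ _ h => by simp only [h])) (const _)
    (fun _ _ l => by cases l <;> rfl) (20 * .X) (fun a l => ?_) (const _) hl
  have h1 : (enc (Formula.bigAnd l)).size ≤ 20 * (enc l).size := by
    induction l with
    | nil => decide
    | cons A l ih =>
      cases l with
      | nil => simp only [Formula.bigAnd, enc_cons, Data.size]; omega
      | cons B l =>
        change 1 + (Data.unary 3).size + (1 + (enc A).size +
          (enc (Formula.bigAnd (B :: l))).size) ≤ 20 * (1 + (enc A).size + (enc (B :: l)).size)
        have : (Data.unary 3).size = 7 := rfl
        omega
  have := size_enc_add_le a l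
  simp; omega

@[fun_prop]
theorem dualCnf {L : α → List (List Literal)} (hL : PolyTime L) :
    PolyTime fun a => dualCnf (L a) :=
  bigOr (map (bigAnd (map (lit id) id)) hL)

@[fun_prop]
theorem duals {Γ : α → Clause} (hΓ : PolyTime Γ) : PolyTime fun a => (Γ a).duals :=
  map (literal_dual id) (sort hΓ)

@[fun_prop]
theorem weakLit {b : α → Literal} (hb : PolyTime b) : PolyTime fun a => weakLit (b a) := by
  unfold Derivation.weakLit; fun_prop

@[fun_prop]
theorem contrLit {b : α → Literal} (hb : PolyTime b) : PolyTime fun a => contrLit (b a) := by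
  unfold Derivation.contrLit; fun_prop

@[fun_prop]
theorem weakConj {l : α → List Literal} (hl : PolyTime l) :
    PolyTime fun a => weakConj (l a) := by
  refine listRec (G := fun (_ : Data) l => Derivation.weakConj l) (f := fun _ => .nil)
    (s := fun p => .step .eq (.formula .bot) (.and (Derivation.weakLit p.2.1) p.2.2.2))
    (by fun_prop) (const _) (fun _ _ _ => rfl) (30 * (40 * .X)) (fun a l => ?_) (const _) hl
  refine size_enc_le_eval (wsize_weakConj_le _ l) ?_
  have := wsize_conj_le_pair a l
  simp; omega

@[fun_prop]
theorem weakDnf {L : α → List (List Literal)} (hL : PolyTime L) :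
    PolyTime fun a => weakDnf (L a) := by
  refine listRec (G := fun (_ : Data) L => Derivation.weakDnf L) (f := fun _ => .nil)
    (s := fun p => .step .eq (.formula .bot) (.or (Derivation.weakConj p.2.1) p.2.2.2))
    (by fun_prop) (const _) (fun _ _ _ => rfl) (30 * (40 * .X)) (fun a l => ?_) (const _) hL
  refine size_enc_le_eval (wsize_weakDnf_le _ l) ?_
  have := wsize_dnf_le_pair a l
  simp; omega

@[fun_prop]
theorem injDnf {m : α → List Literal} {L : α → List (List Literal)} (hm : PolyTime m)
    (hL : PolyTime L) : PolyTime fun a => injDnf (m a) (L a) := by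
  refine listRec (G := Derivation.injDnf)
    (s := fun p => if p.2.1 = p.1 then
        .step .eq (.formula (Formula.conj p.1))
          (.or (.formula (Formula.conj p.1)) (Derivation.weakDnf p.2.2.1))
      else .step .eq (.formula (Formula.conj p.1)) (.or (Derivation.weakConj p.2.1) p.2.2.2))
    (ite_eq (enc_list_injective enc_literal_injective) (by fun_prop) (by fun_prop) (by fun_prop)
      (by fun_prop)) (formula (conj id)) (fun _ _ _ => rfl)
    (40 * .X * (130 + 2 * (40 * .X))) (fun m L => ?_) hm hL
  refine size_enc_le_eval (wsize_injDnf_le _ m L) ?_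
  have h1 := wsize_dnf_le_pair m L
  have h2 : (Formula.conj m).wsize encWeight ≤ 40 * (enc (m, L)).size := by
    have := wsize_conj_le_size m
    have := size_enc_add_le m L
    omega
  simp only [Polynomial.eval_add, Polynomial.eval_mul, Polynomial.eval_X, Polynomial.eval_ofNat]
  gcongr

@[fun_prop]
theorem contrConj {l : α → List Literal} (hl : PolyTime l) :
    PolyTime fun a => contrConj (l a) := by
  refine listRec (G := fun (_ : Data) l => Derivation.contrConj l) (f := fun _ => .nil)
    (s := fun p => .step .medial
      (.formula (.or (Formula.conj (p.2.1 :: p.2.2.1)) (Formula.conj (p.2.1 :: p.2.2.1))))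
      (.and (Derivation.contrLit p.2.1) p.2.2.2))
    (by fun_prop) (const _) (fun _ _ _ => rfl) (10 * (40 * .X) ^ 2) (fun a l => ?_) (const _) hl
  refine size_enc_le_eval (wsize_contrConj_le _ l) ?_
  have := wsize_conj_le_pair a l
  simp only [Polynomial.eval_pow, Polynomial.eval_mul, Polynomial.eval_X, Polynomial.eval_ofNat]
  gcongr

@[fun_prop]
theorem contrDnf {L : α → List (List Literal)} (hL : PolyTime L) :
    PolyTime fun a => contrDnf (L a) := by
  refine listRec (G := fun (_ : Data) l => Derivation.contrDnf l) (f := fun _ => .nil)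
    (s := fun p => .step .eq
      (.formula (.or (Formula.dnf (p.2.1 :: p.2.2.1)) (Formula.dnf (p.2.1 :: p.2.2.1))))
      (.or (Derivation.contrConj p.2.1) p.2.2.2))
    (by fun_prop) (const _) (fun _ _ _ => rfl) (10 * (40 * .X) ^ 2) (fun a l => ?_) (const _) hL
  refine size_enc_le_eval (wsize_contrDnf_le _ l) ?_
  have := wsize_dnf_le_pair a l
  simp only [Polynomial.eval_pow, Polynomial.eval_mul, Polynomial.eval_X, Polynomial.eval_ofNat]
  gcongr

@[fun_prop]
theorem meet {P Q X : α → Formula} {Φ Ψ Ξ : α → Derivation} (hP : PolyTime P) (hQ : PolyTime Q)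
    (hX : PolyTime X) (hΦ : PolyTime Φ) (hΨ : PolyTime Ψ) (hΞ : PolyTime Ξ) :
    PolyTime fun a => meet (P a) (Q a) (X a) (Φ a) (Ψ a) (Ξ a) := by
  unfold Derivation.meet; fun_prop

@[fun_prop]
theorem identLit {b : α → Literal} {l : α → List Literal} (hb : PolyTime b) (hl : PolyTime l) :
    PolyTime fun a => identLit (b a) (l a) := by
  refine listRec (G := Derivation.identLit)
    (s := fun p => Derivation.meet (.lit p.2.1) (Formula.conj p.2.2.1) (.lit p.1)
      (.step .aid (.formula .top) (.formula (.or (.lit p.2.1) (.lit p.1)))) p.2.2.2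
      (Derivation.contrLit p.1)) (by fun_prop)
    (by simp only [Derivation.identLit]; fun_prop) (fun _ _ _ => rfl)
    (60 * (40 * .X * (40 * .X + 20 * .X))) (fun b l => ?_) hb hl
  refine size_enc_le_eval (wsize_identLit_le _ b l) ?_
  have h1 := wsize_conj_le_pair b l
  have h2 : encWeight b ≤ 20 * (enc (b, l)).size := by
    have := encWeight_le b
    have := size_enc_add_le b l
    omega
  simp only [Polynomial.eval_add, Polynomial.eval_mul, Polynomial.eval_X, Polynomial.eval_ofNat]
  gcongr

@[fun_prop]
theorem ident {l m : α → List Literal} (hl : PolyTime l) (hm : PolyTime m) :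
    PolyTime fun a => ident (l a) (m a) := by
  refine listRec (G := Derivation.ident)
    (s := fun p => Derivation.meet (.lit p.2.1) (Formula.conj p.2.2.1) (Formula.conj p.1)
      (.step .eq (Derivation.identLit p.2.1 p.1)
        (.formula (.or (.lit p.2.1) (Formula.conj p.1)))) p.2.2.2
      (Derivation.contrConj p.1)) (by fun_prop)
    (by simp only [Derivation.ident]; fun_prop) (fun _ _ _ => rfl)
    (200 * (40 * .X * (40 * .X) * (40 * .X + 40 * .X))) (fun l m => ?_) hl hm
  refine size_enc_le_eval (wsize_ident_le _ l m) ?_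
  have h1 := wsize_conj_le_pair l m
  have h2 : (Formula.conj l).wsize encWeight ≤ 40 * (enc (l, m)).size := by
    have := wsize_conj_le_size l
    have := size_enc_add_le l m
    omega
  simp only [Polynomial.eval_add, Polynomial.eval_mul, Polynomial.eval_X, Polynomial.eval_ofNat]
  gcongr

@[fun_prop]
theorem cut {R P Q U V : α → Formula} {Φ Ψ Ξ Θ : α → Derivation} (hR : PolyTime R)
    (hP : PolyTime P) (hQ : PolyTime Q) (hU : PolyTime U) (hV : PolyTime V) (hΦ : PolyTime Φ)
    (hΨ : PolyTime Ψ) (hΞ : PolyTime Ξ) (hΘ : PolyTime Θ) :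
    PolyTime fun a => cut (R a) (P a) (Q a) (U a) (V a) (Φ a) (Ψ a) (Ξ a) (Θ a) := by
  unfold Derivation.cut; fun_prop

@[fun_prop]
theorem resolve {L : α → List (List Literal)} {b : α → Literal}
    {x y : α → List Literal × Derivation} (hL : PolyTime L) (hb : PolyTime b) (hx : PolyTime x)
    (hy : PolyTime y) : PolyTime fun a => resolve (L a) (b a) (x a) (y a) := by
  have h1 := filter_eq enc_literal_injective id hx.fst hb.literal_dual
  have h2 := filter_ne enc_literal_injective id hx.fst hb.literal_dual
  have h3 := filter_eq enc_literal_injective id hy.fst hb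
  have h4 := filter_ne enc_literal_injective id hy.fst hb
  unfold Derivation.resolve; fun_prop

@[fun_prop]
theorem find {S : α → Pool} {i : α → ℕ} (hS : PolyTime S) (hi : PolyTime i) :
    PolyTime fun a => (S a).find (i a) := by
  have h := filter_eq enc_nat_injective (fst id) hS hi
  unfold Pool.find; fun_prop

@[fun_prop]
theorem erase {S : α → Pool} {i : α → ℕ} (hS : PolyTime S) (hi : PolyTime i) :
    PolyTime fun a => (S a).erase (i a) :=
  filter_ne enc_nat_injective (fst id) hS hi

theorem next {L : α → List (List Literal)} {k : α → ℕ} {S : α → Pool} {l : α → Line}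
    (hL : PolyTime L) (hk : PolyTime k) (hS : PolyTime S) (hl : PolyTime l) :
    PolyTime fun a => Pool.next (L a) (k a) (S a) (l a) :=
  reasonCases
    (h := fun a => (k a, (l a).clause.duals, Derivation.injDnf (l a).clause.duals (L a)) :: S a)
    (k := fun p => (k p.1, (S p.1).find p.2) :: (S p.1).erase p.2)
    (m := fun p => (k p.1, Derivation.resolve (L p.1) p.2.2.2 ((S p.1).find p.2.1)
      (((S p.1).erase p.2.1).find p.2.2.1)) :: ((S p.1).erase p.2.1).erase p.2.2.1)
    (reason hl) (by fun_prop) (by fun_prop) (by fun_prop)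
    (fun a j h => by simp only [Pool.next, h]) (fun a i h => by simp only [Pool.next, h])
    (fun a i j b h => by simp only [Pool.next, h])

end PolyTime

/-! ### Size of the encoded pool -/

namespace Pool

/-- Bounds the number of entries and their labels, which are written in unary in the encoded pool.
-/
theorem run_lt (L : List (List Literal)) (ls : List Line) :
    (run L ls).length ≤ ls.length ∧ ∀ e ∈ run L ls, e.1 < ls.length := by
  induction ls with
  | nil => simp [run]
  | cons l ls ih =>
    obtain ⟨h1, h2⟩ := ih
    have key : ∀ (x : List Literal × Derivation) (S : Pool), S.Sublist (run L ls) →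
        ((ls.length, x) :: S).length ≤ (l :: ls).length ∧
          ∀ e ∈ (ls.length, x) :: S, e.1 < (l :: ls).length := by
      intro x S hS
      refine ⟨Nat.succ_le_succ (hS.length_le.trans h1), fun e he => ?_⟩
      rcases List.mem_cons.1 he with rfl | he
      · exact Nat.lt_succ_self _
      · exact Nat.lt_succ_of_lt (h2 e (hS.subset he))
    rw [run]
    unfold next
    split
    · exact key _ _ (List.Sublist.refl _)
    · exact key _ _ List.filter_sublist
    · exact key _ _ (List.filter_sublist.trans List.filter_sublist)

theorem size_enc_le {S : Pool} {k : ℕ} (hS : ∀ e ∈ S, e.1 < k) :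
    (enc S).size ≤ S.length * (2 * k + 60) + total (fun x => listWeight encWeight x.1) S +
      total (fun x => x.2.wsize encWeight) S + 1 := by
  induction S with
  | nil => simp [enc_nil, Data.size]
  | cons e S ih =>
    obtain ⟨i, l, Φ⟩ := e
    have h1 := ih fun e he => hS e (List.mem_cons_of_mem _ he)
    have h2 : i < k := hS _ List.mem_cons_self
    have h3 := Φ.size_enc_le
    have h4 : ∀ n : ℕ, (enc n).size = 2 * n + 1 := fun n => by
      induction n with
      | zero => rfl
      | succ n ih => change 1 + 1 + (enc n).size = _; omega
    have h5 : (enc l).size ≤ listWeight encWeight l + 1 := by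
      clear hS
      induction l with
      | nil => simp [enc_nil, Data.size]
      | cons a l ih =>
        have := a.size_enc.2
        simp only [enc_cons, Data.size, listWeight, List.map_cons, List.sum_cons] at *
        omega
    simp only [enc_cons, enc_pair, Data.size, h4, total_cons, List.length_cons,
      Nat.succ_mul S.length]
    omega

/-- `encWeight` depends only on the variable and is therefore invariant under duality. -/
theorem listWeight_duals_le (Γ : Clause) :
    listWeight encWeight Γ.duals ≤ 40 * (enc Γ).size := by
  have : ∀ l : List Literal,
      listWeight encWeight (l.map Literal.dual) ≤ 40 * (enc l).size := by
    intro l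
    induction l with
    | nil => simp [listWeight]
    | cons a l ih =>
      have := a.size_enc.1
      simp only [enc_cons, Data.size, listWeight, List.map_cons, List.sum_cons] at *
      have : encWeight a.dual = (Data.binary a.var).size + 20 := rfl
      omega
  exact this _

theorem sum_listWeight_le (ls : List Line) :
    (ls.map fun l => listWeight encWeight l.clause.duals).sum ≤ 40 * (enc ls).size := by
  induction ls with
  | nil => simp
  | cons l ls ih =>
    have h1 := listWeight_duals_le l.clause
    have h2 : (enc l).size = 1 + (enc l.clause).size + (enc l.reason).size := rfl
    simp only [enc_cons, Data.size, List.map_cons, List.sum_cons]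
    omega

end Pool

/-! ### The program for the whole translation -/

namespace PolyTime

variable {α : Type*} [Enc α]

/-- Bounded recursion needs a bound for arbitrary lists of lines, tree-like or not; the erasing pool
provides it. -/
theorem run {L : α → List (List Literal)} {ls : α → List Line} (hL : PolyTime L)
    (hls : PolyTime ls) : PolyTime fun a => Pool.run (L a) (ls a) := by
  refine listRec (G := Pool.run)
    (s := fun p => Pool.next p.1 p.2.2.1.length p.2.2.2 p.2.1)
    (next (by fun_prop) (by fun_prop) (by fun_prop) (by fun_prop)) (const _)
    (fun _ _ _ => rfl) (.X * (2 * .X + 60) + 40 * .X + .X * (80 + 500 * (40 * .X + 40) ^ 3 +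
      10 * (40 * .X) ^ 2 + 40 * .X * (170 + 2 * (40 * .X))) + 1) (fun L ls => ?_) hL hls
  have h0 := length_le_size ls
  have h1 := size_enc_add_le L ls
  have h2 := (Pool.total_listWeight_run_le encWeight L ls).trans (Pool.sum_listWeight_le ls)
  have h3 := Pool.total_wsize_run_le encWeight L ls
  obtain ⟨h4, h5⟩ := Pool.run_lt L ls
  refine (Pool.size_enc_le h5).trans ?_
  obtain ⟨n, hn⟩ : ∃ n, n = (enc (L, ls)).size := ⟨_, rfl⟩
  have h6 := h3.trans (Nat.mul_le_mul (show ls.length ≤ n by omega)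
    (Pool.growth_mono (d' := 40 * n) (n' := 40 * n)
      ((wsize_dnf_le_size L).trans (by omega)) ((Pool.sum_listWeight_le ls).trans (by omega))))
  have h7 := Nat.mul_le_mul (show (Pool.run L ls).length ≤ n by omega)
    (show 2 * ls.length + 60 ≤ 2 * n + 60 by omega)
  rw [← hn]
  simp only [Polynomial.eval_add, Polynomial.eval_mul, Polynomial.eval_pow, Polynomial.eval_X,
    Polynomial.eval_ofNat, Polynomial.eval_one]
  unfold Pool.growth at h6
  omega

theorem toKS : PolyTime ResDerivation.toKS := by
  have h1 := map (duals id) (initial (id (α := ResDerivation)))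
  have h2 := run h1 (reverse (lines id))
  unfold ResDerivation.toKS
  fun_prop

end PolyTime

end DeepInf

/-! ### The simulation theorem -/

theorem mainTheorem4 :
    ∃ f : DeepInf.ResDerivation → DeepInf.Derivation,
      (∀ π : DeepInf.ResDerivation, π.IsTreeLikeRefutation →
        (f π).IsKSProofOf (DeepInf.cnf π.initial).dual) ∧
      DeepInf.PolyTimeOn {π : DeepInf.ResDerivation | π.IsTreeLikeRefutation}
        DeepInf.ResDerivation.encode DeepInf.Derivation.encode f ∧
      ∃ p : Polynomial ℕ, ∀ π : DeepInf.ResDerivation, π.IsTreeLikeRefutation →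
        (f π).size ≤ p.eval π.size := by
  refine ⟨DeepInf.ResDerivation.toKS, fun π h => π.toKS_proves h, ?_, ?_⟩
  · obtain ⟨c, _, p, hc⟩ := DeepInf.PolyTime.toKS
    refine ⟨c, p, fun π _ => ?_⟩
    obtain ⟨τ, t, hr, ht, h0, -⟩ := hc π (DeepInf.Store.init π.encode) (Function.update_self _ _ _)
    exact ⟨τ, t, hr, h0, ht⟩
  · obtain ⟨p, hp⟩ := DeepInf.ResDerivation.size_toKS_le
    exact ⟨p, fun π _ => hp π⟩
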